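/- Let $n \ge 1$ and let $f \in \mathbb{C}[\mathrm{GL}_n(\mathbb{C})]$ be a regular function, i.e. $f = \det^N \cdot P$ with $N \in \mathbb{Z}$ and $P$ a polynomial in the matrix entries. For $m \in \mathbb{Z}^n$ let $Q_m(A,B)$ be defined by $f(A\,\mathrm{diag}(z)B^{-1}) = \sum_{m \in \mathbb{Z}^n} Q_m(A,B) z^m$ for all $z \in (\mathbb{C}^*)^n$ and $A, B \in \mathrm{GL}_n(\mathbb{C})$, let $S_f$ be the set of $m$ with $Q_m \not\equiv 0$, and let $\mathrm{sNewt}(f) \subset \mathbb{R}^n$ be the convex hull of $S_f$. Let $\mathrm{s}\mathcal{A}(f) \subset \mathbb{R}^n$ be the matrix amoeba of $f$, i.e. the (permutation invariant) set of all vectors $(\ln\lambda_1, \dots, \ln\lambda_n)$ where $\lambda_1, \dots, \lambda_n$ are the singular values, in any order, of a matrix $A \in \mathrm{GL}_n(\mathbb{C})$ with $f(A) = 0$. Let $$R_f(x) = \int_{\mathrm{U}(n)}\int_{\mathrm{U}(n)} \ln |f(U \exp(\mathrm{diag}(x)) V^*)| \, d\mu(U)\, d\mu(V) \in \mathbb{R}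 \cup \{-\infty\}$$ be the Ronkin function of $f$, where $\mu$ is the Haar probability measure on $\mathrm{U}(n)$. The order $\nu_f(E)$ of a connected component $E$ of $\mathbb{R}^n \setminus \mathrm{s}\mathcal{A}(f)$ is the gradient $\nabla R_f(x)$ at a point $x \in E$. Write $\mathbf{1} = (1, \dots, 1)$ and, for a vertex $v$ of $\mathrm{sNewt}(f)$, let $C_{\{v\}} = \{w \in \mathbb{R}^n : w \cdot v \le w \cdot y \text{ for all } y \in \mathrm{sNewt}(f)\}$ be its normal cone. Let $v$ be a vertex of $\mathrm{sNewt}(f)$. (a) If $v \in \mathbb{Z}\mathbf{1}$, then some connected component $E$ of $\mathbb{R}^n \setminus \mathrm{s}\mathcal{A}(f)$ has order $v$ (with $\nabla R_f = v$ on all of $E$). Moreover $\mathbf{1} \in C_{\{v\}}$ or $-\mathbf{1} \in C_{\{v\}}$, and every component of order $v$ is unbounded and contains a half-line of the line $\mathbb{R}\mathbf{1}$. (b) If $v \notin \mathbb{Z}\mathbf{1}$, then no connected component of $\mathbb{R}^n \setminus \mathrm{s}\mathcal{A}(f)$ has order $v$. In particular, at most two vertices of $\mathrm{sNewt}(f)$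 are orders of connected components of $\mathbb{R}^n \setminus \mathrm{s}\mathcal{A}(f)$. -/

import Mathlib

open Matrix MeasureTheory Topology

namespace MatrixAmoeba

noncomputable section

/-! ### Regular functions on the general linear group and their Laurent expansions -/

/-- The regular functions on `GL_n(ℂ)`: the functions `det ^ N * P`, where `P` is a polynomial in
the matrix entries and `N` is an integer. -/
def IsRegularFunction {n : ℕ} (f : GL (Fin n) ℂ → ℂ) : Prop :=
  ∃ (N : ℤ) (P : MvPolynomial (Fin n × Fin n) ℂ), ∀ A : GL (Fin n) ℂ,
    f A = (A : Matrix (Fin n) (Fin n) ℂ).det ^ N *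
      MvPolynomial.eval (fun ij => (A : Matrix (Fin n) (Fin n) ℂ) ij.1 ij.2) P

/-- The diagonal matrix `diag(z)`, for `z` in the torus `T = (ℂ^*)^n`. -/
def diagGL {n : ℕ} (z : Fin n → ℂˣ) : GL (Fin n) ℂ where
  val := Matrix.diagonal fun i => (z i : ℂ)
  inv := Matrix.diagonal fun i => ((z i)⁻¹ : ℂˣ)
  val_inv := by simp [Matrix.diagonal_mul_diagonal]
  inv_val := by simp [Matrix.diagonal_mul_diagonal]

/-- `Ψ_{A,B}(f)`, the function `z ↦ f (A diag(z) B⁻¹)` on the torus. -/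
def Psi {n : ℕ} (f : GL (Fin n) ℂ → ℂ) (A B : GL (Fin n) ℂ) : (Fin n → ℂˣ) → ℂ :=
  fun z => f (A * diagGL z * B⁻¹)

/-- The Laurent monomial `z ^ m`. -/
def laurentMonomial {n : ℕ} (m : Fin n → ℤ) (z : Fin n → ℂˣ) : ℂ :=
  ∏ i, (z i : ℂ) ^ m i

/-- `g z = ∑ m, c m * z ^ m` (a finite sum) on the torus. -/
def IsLaurentExpansion {n : ℕ} (g : (Fin n → ℂˣ) → ℂ) (c : (Fin n → ℤ) →₀ ℂ) : Prop :=
  ∀ z, g z = c.sum fun m a => a * laurentMonomial m z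

open scoped Classical in
/-- The coefficients of `g` as a Laurent polynomial (zero if `g` is not a Laurent polynomial). -/
def laurentCoeff {n : ℕ} (g : (Fin n → ℂˣ) → ℂ) : (Fin n → ℤ) →₀ ℂ :=
  if h : ∃ c, IsLaurentExpansion g c then h.choose else 0

/-- The coefficient functions `Q_m` of `f`, given by `f (A diag(z) B⁻¹) = ∑ m, Q_m(A, B) z ^ m`;
see `Q_spec` and `Q_unique`. -/
def Q {n : ℕ} (f : GL (Fin n) ℂ → ℂ) (m : Fin n → ℤ) (A B : GL (Fin n) ℂ) : ℂ :=
  laurentCoeff (Psi f A B) m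

theorem laurentMonomial_add {n : ℕ} (m k : Fin n → ℤ) (z : Fin n → ℂˣ) :
    laurentMonomial (m + k) z = laurentMonomial m z * laurentMonomial k z := by
  simp [laurentMonomial, zpow_add₀, Finset.prod_mul_distrib]

theorem laurentMonomial_zero {n : ℕ} (z : Fin n → ℂˣ) :
    laurentMonomial (0 : Fin n → ℤ) z = 1 := by
  simp [laurentMonomial]

/-- `laurentMonomial` as a character of the torus. -/
def laurentHom {n : ℕ} (m : Fin n → ℤ) : (Fin n → ℂˣ) →* ℂ where
  toFun := laurentMonomial m
  map_one' := by simp [laurentMonomial]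
  map_mul' z w := by simp [laurentMonomial, mul_zpow, Finset.prod_mul_distrib]

theorem laurentHom_injective {n : ℕ} :
    Function.Injective (laurentHom : (Fin n → ℤ) → ((Fin n → ℂˣ) →* ℂ)) := by
  intro m k h
  funext i
  have h2 := DFunLike.congr_fun h (Pi.mulSingle i (Units.mk0 (2 : ℂ) two_ne_zero))
  have key : ∀ m : Fin n → ℤ,
      laurentMonomial m (Pi.mulSingle i (Units.mk0 (2 : ℂ) two_ne_zero)) = (2 : ℂ) ^ m i := by
    intro m
    unfold laurentMonomial
    rw [Finset.prod_eq_single i]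
    · simp
    · intro j _ hj
      simp [Pi.mulSingle_eq_of_ne hj]
    · simp
  change laurentMonomial m _ = laurentMonomial k _ at h2
  rw [key, key] at h2
  have h3 : (2 : ℝ) ^ m i = (2 : ℝ) ^ k i := by simpa using congrArg norm h2
  exact zpow_right_injective₀ (by norm_num) (by norm_num) h3

/-- A function on the torus has at most one Laurent expansion. -/
theorem IsLaurentExpansion.unique {n : ℕ} {g : (Fin n → ℂˣ) → ℂ} {c d : (Fin n → ℤ) →₀ ℂ}
    (hc : IsLaurentExpansion g c) (hd : IsLaurentExpansion g d) : c = d := by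
  have hli : LinearIndependent ℂ
      (fun m : Fin n → ℤ => (laurentHom m : (Fin n → ℂˣ) → ℂ)) :=
    (linearIndependent_monoidHom (Fin n → ℂˣ) ℂ).comp laurentHom laurentHom_injective
  apply hli
  funext z
  have e : ∀ c : (Fin n → ℤ) →₀ ℂ,
      (Finsupp.linearCombination ℂ (fun m => (laurentHom m : (Fin n → ℂˣ) → ℂ)) c) z =
        c.sum fun m a => a * laurentMonomial m z := by
    intro c
    simp only [Finsupp.linearCombination_apply, Finsupp.sum, Finset.sum_apply, Pi.smul_apply,
      smul_eq_mul]
    rfl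
  rw [e, e, ← hc z, ← hd z]

theorem exists_isLaurentExpansion_add {n : ℕ} {g h : (Fin n → ℂˣ) → ℂ}
    (hg : ∃ c, IsLaurentExpansion g c) (hh : ∃ c, IsLaurentExpansion h c) :
    ∃ c, IsLaurentExpansion (g + h) c := by
  obtain ⟨c, hc⟩ := hg
  obtain ⟨d, hd⟩ := hh
  refine ⟨c + d, fun z => ?_⟩
  rw [Finsupp.sum_add_index' (by simp) (by intros; ring), Pi.add_apply, hc z, hd z]

theorem exists_isLaurentExpansion_monomial {n : ℕ} (a : ℂ) (m : Fin n → ℤ) :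
    ∃ c, IsLaurentExpansion (fun z => a * laurentMonomial m z) c :=
  ⟨Finsupp.single m a, fun z => by simp⟩

theorem exists_isLaurentExpansion_sum {n : ℕ} {ι : Type*} (s : Finset ι)
    (g : ι → (Fin n → ℂˣ) → ℂ) (hg : ∀ i ∈ s, ∃ c, IsLaurentExpansion (g i) c) :
    ∃ c, IsLaurentExpansion (∑ i ∈ s, g i) c := by
  classical
  induction s using Finset.induction_on with
  | empty => exact ⟨0, fun z => by simp⟩
  | insert i s hi ih =>
    rw [Finset.sum_insert hi]
    exact exists_isLaurentExpansion_add (hg i (by simp))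
      (ih fun j hj => hg j (by simp [hj]))

theorem exists_isLaurentExpansion_mul {n : ℕ} {g h : (Fin n → ℂˣ) → ℂ}
    (hg : ∃ c, IsLaurentExpansion g c) (hh : ∃ c, IsLaurentExpansion h c) :
    ∃ c, IsLaurentExpansion (g * h) c := by
  obtain ⟨c, hc⟩ := hg
  obtain ⟨d, hd⟩ := hh
  have : g * h = ∑ m ∈ c.support, ∑ k ∈ d.support,
      fun z => (c m * d k) * laurentMonomial (m + k) z := by
    funext z
    simp only [Pi.mul_apply, Finset.sum_apply, hc z, hd z, Finsupp.sum, Finset.sum_mul_sum,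
      laurentMonomial_add]
    refine Finset.sum_congr rfl fun m _ => Finset.sum_congr rfl fun k _ => ?_
    ring
  rw [this]
  exact exists_isLaurentExpansion_sum _ _ fun m _ =>
    exists_isLaurentExpansion_sum _ _ fun k _ => exists_isLaurentExpansion_monomial _ _

/-- `Ψ_{A,B}(f)` is a Laurent polynomial when `f` is a regular function. -/
theorem exists_isLaurentExpansion_Psi {n : ℕ} {f : GL (Fin n) ℂ → ℂ} (hf : IsRegularFunction f)
    (A B : GL (Fin n) ℂ) : ∃ c, IsLaurentExpansion (Psi f A B) c := by
  obtain ⟨N, P, hP⟩ := hf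
  have hconst : ∀ a : ℂ, ∃ c, IsLaurentExpansion (fun _ : Fin n → ℂˣ => a) c := fun a => by
    simpa [laurentMonomial_zero] using exists_isLaurentExpansion_monomial a (0 : Fin n → ℤ)
  have hcoord : ∀ k : Fin n, ∃ c, IsLaurentExpansion (fun z : Fin n → ℂˣ => (z k : ℂ)) c := by
    intro k
    have := exists_isLaurentExpansion_monomial (1 : ℂ) (Pi.single k (1 : ℤ))
    refine this.imp fun c hc z => ?_
    rw [← hc z]
    change (z k : ℂ) = 1 * laurentMonomial (Pi.single k 1) z
    unfold laurentMonomial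
    rw [one_mul, Finset.prod_eq_single k]
    · simp
    · intro j _ hj
      simp [Pi.single_eq_of_ne hj]
    · simp
  have hentry : ∀ i j : Fin n, ∃ c, IsLaurentExpansion
      (fun z => ((A * diagGL z * B⁻¹ : GL (Fin n) ℂ) : Matrix (Fin n) (Fin n) ℂ) i j) c := by
    intro i j
    have e : (fun z => ((A * diagGL z * B⁻¹ : GL (Fin n) ℂ) : Matrix (Fin n) (Fin n) ℂ) i j) =
        ∑ k : Fin n, (fun _ : Fin n → ℂˣ => (A : Matrix (Fin n) (Fin n) ℂ) i k *
          ((B⁻¹ : GL (Fin n) ℂ) : Matrix (Fin n) (Fin n) ℂ) k j) *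
          fun z : Fin n → ℂˣ => (z k : ℂ) := by
      funext z
      simp only [Units.val_mul, Matrix.mul_apply, diagGL, Finset.sum_apply, Pi.mul_apply]
      refine Finset.sum_congr rfl fun k _ => ?_
      rw [Finset.sum_eq_single k]
      · rw [Matrix.diagonal_apply_eq]; ring
      · intro l _ hl
        rw [Matrix.diagonal_apply_ne _ hl, mul_zero]
      · simp
    rw [e]
    exact exists_isLaurentExpansion_sum _ _ fun k _ =>
      exists_isLaurentExpansion_mul (hconst _) (hcoord k)
  have hpoly : ∃ c, IsLaurentExpansion (fun z => MvPolynomial.eval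
      (fun ij : Fin n × Fin n =>
        ((A * diagGL z * B⁻¹ : GL (Fin n) ℂ) : Matrix (Fin n) (Fin n) ℂ) ij.1 ij.2) P) c := by
    clear hP
    induction P using MvPolynomial.induction_on with
    | C a => simpa using hconst a
    | add p q hp hq =>
      simp only [map_add]
      exact exists_isLaurentExpansion_add hp hq
    | mul_X p ij hp =>
      simp only [map_mul, MvPolynomial.eval_X]
      exact exists_isLaurentExpansion_mul hp (hentry ij.1 ij.2)
  have hdet : ∃ c, IsLaurentExpansion (fun z =>
      ((A * diagGL z * B⁻¹ : GL (Fin n) ℂ) : Matrix (Fin n) (Fin n) ℂ).det ^ N) c := by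
    refine (exists_isLaurentExpansion_monomial (((A : Matrix (Fin n) (Fin n) ℂ).det *
      ((B⁻¹ : GL (Fin n) ℂ) : Matrix (Fin n) (Fin n) ℂ).det) ^ N) (fun _ => N)).imp
      fun c hc z => ?_
    rw [← hc z]
    simp only [Units.val_mul, Matrix.det_mul, diagGL, Matrix.det_diagonal, laurentMonomial,
      mul_zpow, ← Finset.prod_zpow]
    ring
  obtain ⟨c, hc⟩ := exists_isLaurentExpansion_mul hdet hpoly
  refine ⟨c, fun z => ?_⟩
  rw [← hc z]
  exact hP _

/-- The identity defining the `Q_m`. -/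
theorem Q_spec {n : ℕ} {f : GL (Fin n) ℂ → ℂ} (hf : IsRegularFunction f) (A B : GL (Fin n) ℂ) :
    IsLaurentExpansion (Psi f A B) (laurentCoeff (Psi f A B)) := by
  have h := exists_isLaurentExpansion_Psi hf A B
  rw [laurentCoeff, dif_pos h]
  exact h.choose_spec

/-- The identity defining the `Q_m` determines them. -/
theorem Q_unique {n : ℕ} {f : GL (Fin n) ℂ → ℂ} {A B : GL (Fin n) ℂ} {c : (Fin n → ℤ) →₀ ℂ}
    (hc : IsLaurentExpansion (Psi f A B) c) (m : Fin n → ℤ) : Q f m A B = c m := by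
  have h : ∃ c, IsLaurentExpansion (Psi f A B) c := ⟨c, hc⟩
  rw [Q, laurentCoeff, dif_pos h, h.choose_spec.unique hc]

/-! ### The matrix Newton polytope -/

/-- The support `S_f`: the exponents `m` such that `Q_m` is not identically zero. -/
def support {n : ℕ} (f : GL (Fin n) ℂ → ℂ) : Set (Fin n → ℤ) :=
  {m | ∃ A B : GL (Fin n) ℂ, Q f m A B ≠ 0}

/-- The inclusion of `ℤ^n` into `ℝ^n`. -/
def toReal {n : ℕ} (m : Fin n → ℤ) : EuclideanSpace ℝ (Fin n) :=
  WithLp.toLp 2 fun i => (m i : ℝ)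

/-- The matrix Newton polytope of `f`. -/
def sNewt {n : ℕ} (f : GL (Fin n) ℂ → ℂ) : Set (EuclideanSpace ℝ (Fin n)) :=
  convexHull ℝ (toReal '' support f)

/-- The vertices of the matrix Newton polytope. -/
def vertices {n : ℕ} (f : GL (Fin n) ℂ → ℂ) : Set (EuclideanSpace ℝ (Fin n)) :=
  Set.extremePoints ℝ (sNewt f)

/-- The vector `𝟏 = (1, …, 1)`. -/
def ones (n : ℕ) : EuclideanSpace ℝ (Fin n) := WithLp.toLp 2 fun _ => 1

/-- The set `ℤ𝟏` of integer multiples of `𝟏`. -/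
def diagonalLattice (n : ℕ) : Set (EuclideanSpace ℝ (Fin n)) :=
  {v | ∃ k : ℤ, v = (k : ℝ) • ones n}

/-- The normal cone `C_F(Δ)` of `Δ` at `F`. -/
def normalCone {n : ℕ} (Δ F : Set (EuclideanSpace ℝ (Fin n))) :
    Set (EuclideanSpace ℝ (Fin n)) :=
  {w | ∀ x ∈ F, ∀ y ∈ Δ, inner ℝ w x ≤ inner ℝ w y}

/-! ### The matrix amoeba -/

/-- The logarithms of the singular values of `A`, in decreasing order. -/
def sLog {n : ℕ} (A : GL (Fin n) ℂ) : EuclideanSpace ℝ (Fin n) :=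
  WithLp.toLp 2 fun i => Real.log
    ((Matrix.toEuclideanLin (A : Matrix (Fin n) (Fin n) ℂ)).singularValues i)

/-- The matrix amoeba of the hypersurface `f = 0`, as a permutation invariant subset of `ℝ^n`. -/
def amoeba {n : ℕ} (f : GL (Fin n) ℂ → ℂ) : Set (EuclideanSpace ℝ (Fin n)) :=
  {x | ∃ A : GL (Fin n) ℂ, f A = 0 ∧ ∃ σ : Equiv.Perm (Fin n), ∀ i, x i = sLog A (σ i)}

/-- The connected components of the complement of the amoeba. -/
def complementComponents {n : ℕ} (f : GL (Fin n) ℂ → ℂ) : Set (Set (EuclideanSpace ℝ (Fin n))) :=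
  {E | ∃ x ∈ (amoeba f)ᶜ, E = connectedComponentIn (amoeba f)ᶜ x}

/-! ### The Ronkin function and the order of a complement component -/

instance unitaryMeasurableSpace (n : ℕ) : MeasurableSpace (Matrix.unitaryGroup (Fin n) ℂ) :=
  borel _

instance unitaryBorelSpace (n : ℕ) : BorelSpace (Matrix.unitaryGroup (Fin n) ℂ) := ⟨rfl⟩

instance unitaryCompactSpace (n : ℕ) : CompactSpace (Matrix.unitaryGroup (Fin n) ℂ) := by
  refine (isCompact_iff_compactSpace
    (s := (Matrix.unitaryGroup (Fin n) ℂ : Set (Matrix (Fin n) (Fin n) ℂ)))).mp ?_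
  have hc : IsCompact (Set.pi Set.univ fun _ : Fin n => Set.pi Set.univ fun _ : Fin n =>
      Metric.closedBall (0 : ℂ) 1) :=
    isCompact_univ_pi fun _ => isCompact_univ_pi fun _ => isCompact_closedBall _ _
  refine IsCompact.of_isClosed_subset hc ?_ ?_
  · have : (Matrix.unitaryGroup (Fin n) ℂ : Set (Matrix (Fin n) (Fin n) ℂ)) =
        {A | A * star A = 1} := by
      ext A
      exact Matrix.mem_unitaryGroup_iff
    rw [this]
    exact isClosed_eq (by fun_prop) continuous_const
  · intro A hA i _ j _
    simpa using entry_norm_bound_of_unitary hA i j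

/-- The Haar probability measure on the unitary group `U(n)`. -/
def haarU (n : ℕ) : Measure (Matrix.unitaryGroup (Fin n) ℂ) :=
  Measure.haarMeasure ⊤

/-- The diagonal matrix `exp(diag(x))`. -/
def expDiag {n : ℕ} (x : EuclideanSpace ℝ (Fin n)) : GL (Fin n) ℂ :=
  diagGL fun i => Units.mk0 (Complex.exp (x i)) (Complex.exp_ne_zero _)

/-- The value `f (U exp(diag(x)) V^*)`, for a pair `p = (U, V)` of unitary matrices. -/
def orbitValue {n : ℕ} (f : GL (Fin n) ℂ → ℂ) (x : EuclideanSpace ℝ (Fin n))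
    (p : Matrix.unitaryGroup (Fin n) ℂ × Matrix.unitaryGroup (Fin n) ℂ) : ℂ :=
  f (Unitary.toUnits p.1 * expDiag x * Unitary.toUnits (star p.2))

open scoped Classical in
/-- The Ronkin function `R_f(x) = ∫∫ ln |f (U exp(diag(x)) V^*)| dμ(U) dμ(V)`, with values in
`ℝ ∪ {-∞}`. The integrand (with `ln 0 = -∞`) is bounded above for regular `f`, so the integral is
`-∞` exactly when the integrand fails to be almost everywhere finite and integrable. -/
def ronkin {n : ℕ} (f : GL (Fin n) ℂ → ℂ) (x : EuclideanSpace ℝ (Fin n)) : EReal :=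
  if (∀ᵐ p ∂((haarU n).prod (haarU n)), orbitValue f x p ≠ 0) ∧
      Integrable (fun p => Real.log ‖orbitValue f x p‖) ((haarU n).prod (haarU n)) then
    ((∫ p, Real.log ‖orbitValue f x p‖ ∂((haarU n).prod (haarU n)) : ℝ) : EReal)
  else ⊥

/-- `∇R_f(x) = v`: near `x` the Ronkin function is finite, and it has gradient `v` at `x`. -/
def HasRonkinGradientAt {n : ℕ} (f : GL (Fin n) ℂ → ℂ) (v x : EuclideanSpace ℝ (Fin n)) : Prop :=
  ∃ R : EuclideanSpace ℝ (Fin n) → ℝ,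
    (∀ᶠ y in 𝓝 x, ronkin f y = (R y : EReal)) ∧ HasGradientAt R v x

/-- `v` is the order `ν_f(E)`, i.e. `v = ∇R_f(x)` for some `x` in `E`. -/
def IsOrder {n : ℕ} (f : GL (Fin n) ℂ → ℂ) (E : Set (EuclideanSpace ℝ (Fin n)))
    (v : EuclideanSpace ℝ (Fin n)) : Prop :=
  ∃ x ∈ E, HasRonkinGradientAt f v x

/-- The image of the order function `ν_f`. -/
def orderImage {n : ℕ} (f : GL (Fin n) ℂ → ℂ) : Set (EuclideanSpace ℝ (Fin n)) :=
  {v | ∃ E ∈ complementComponents f, IsOrder f E v}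

/-- `E` contains a half-line of the line `ℝ𝟏`. -/
def ContainsDiagonalHalfLine {n : ℕ} (E : Set (EuclideanSpace ℝ (Fin n))) : Prop :=
  ∃ t₀ : ℝ, (∀ t : ℝ, t₀ ≤ t → t • ones n ∈ E) ∨ (∀ t : ℝ, t ≤ t₀ → t • ones n ∈ E)

end

end MatrixAmoeba

open MatrixAmoeba

/-!
The proof rests on two facts about the function `f (U exp(diag x) V^*)` at a point `x` off the
amoeba, where by the singular value decomposition (`mem_amoeba_iff`) it vanishes for no pair
`(U, V)` of unitary matrices.

*Every order is a multiple of `𝟏`.* Averaging the Ronkin integral over coordinate circles, which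
are absorbed by Haar measure (`ronkinReal_eq_integral_logMean`), Jensen's formula for Laurent
polynomials (`exists_logMean_slope`) shows that it is locally affine in each coordinate, and that
the slope is the average over `(U, V)` of an integer depending continuously on all data. The `i`-th
coordinate circle is the conjugate of the `j`-th one by a transposition matrix `T`. As `T` is
joined to `1` by a path in `U(n)`, the integers cannot jump along this deformation, and
the two slopes agree (`ronkinReal_single_eq`). Since the common slope is constant along all
coordinate directions, the Ronkin function is locally an affine function of the coordinate sum
(`exists_ronkinReal_local_affine`). A vertex of the Newton polytope has integer coordinates, so it
can only be an order if it lies in `ℤ𝟏`.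

*The component of a vertex `k𝟏`.* The polytope is permutation invariant, so averaging over cyclic
shifts shows that `k𝟏` is the strict minimum or the strict maximum of the coordinate sum on the
support (`exists_sign_of_vertex`); in particular there are at most two such vertices. Let `ε = 1` or
`ε = -1` accordingly. Then `f (τ ^ ε g)` is `τ ^ (ε n k)` times a polynomial in `τ` whose
constant term, as a function of `g`, vanishes nowhere (`exists_extreme_expansion`). Jensen's
formula in the direction `ε𝟏` now says that the gradient at `x` is `k𝟏` if and only if the
half-line from `x` in the direction `-ε𝟏` avoids the amoeba (`slope_eq_iff`). By compactness, all
bounded translates of the half-line avoid the amoeba far out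
(`eventually_translate_notMem_amoeba`). This gives a component of order `k𝟏`, and connects every
other point `x` of order `k𝟏` with the diagonal.
-/

namespace MatrixAmoeba

/-! ### The matrix Newton polytope near a symmetric vertex -/

/-- The permutation matrix of `σ` as a unitary matrix; its row `i` is the basis vector `σ i`. -/
noncomputable def permU {n : ℕ} (σ : Equiv.Perm (Fin n)) : Matrix.unitaryGroup (Fin n) ℂ :=
  ⟨σ.permMatrix ℂ, by
    rw [Matrix.mem_unitaryGroup_iff, Matrix.star_eq_conjTranspose, Matrix.conjTranspose_permMatrix,
      ← Matrix.permMatrix_mul]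
    simp⟩

theorem permU_mul_diagGL {n : ℕ} (σ : Equiv.Perm (Fin n)) (z : Fin n → ℂˣ) :
    Unitary.toUnits (permU σ) * diagGL z = diagGL (z ∘ σ) * Unitary.toUnits (permU σ) := by
  apply Units.ext
  ext i j
  simp [diagGL, permU, Matrix.mul_diagonal, Matrix.diagonal_mul, Equiv.Perm.permMatrix,
    PEquiv.toMatrix_apply]
  grind

theorem laurentMonomial_comp_perm {n : ℕ} (σ : Equiv.Perm (Fin n)) (m : Fin n → ℤ)
    (z : Fin n → ℂˣ) :
    laurentMonomial m (z ∘ σ) = laurentMonomial (m ∘ σ.symm) z := by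
  unfold laurentMonomial
  rw [← Equiv.prod_comp σ fun i => (z i : ℂ) ^ (m ∘ σ.symm) i]
  simp

/-- The support is permutation invariant: replacing `(A, B)` by `(A T, B T)` for a permutation
matrix `T` permutes the torus variables. -/
theorem comp_perm_mem_support {n : ℕ} {f : GL (Fin n) ℂ → ℂ} (hf : IsRegularFunction f)
    {m : Fin n → ℤ} (hm : m ∈ support f) (σ : Equiv.Perm (Fin n)) : m ∘ σ ∈ support f := by
  obtain ⟨A, B, hAB⟩ := hm
  set T : GL (Fin n) ℂ := Unitary.toUnits (permU σ⁻¹) with hT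
  set c := laurentCoeff (Psi f A B) with hc
  have hinj : Function.Injective fun m : Fin n → ℤ => m ∘ σ :=
    σ.surjective.injective_comp_right
  have hexp : IsLaurentExpansion (Psi f (A * T) (B * T)) (c.mapDomain fun m => m ∘ σ) := by
    intro z
    have e : Psi f (A * T) (B * T) z = Psi f A B (z ∘ ⇑(σ⁻¹)) := by
      unfold Psi
      congr 1
      have h := permU_mul_diagGL σ⁻¹ z
      rw [← hT] at h
      rw [mul_assoc A T, h]
      group
    rw [e, Q_spec hf A B (z ∘ ⇑(σ⁻¹)), Finsupp.sum_mapDomain_index_inj hinj]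
    refine Finsupp.sum_congr fun m _ => ?_
    rw [laurentMonomial_comp_perm]
    rfl
  refine ⟨A * T, B * T, ?_⟩
  rw [Q_unique hexp, Finsupp.mapDomain_apply hinj]
  exact hAB

theorem inner_ones {n : ℕ} (x : EuclideanSpace ℝ (Fin n)) : inner ℝ (ones n) x = ∑ i, x i := by
  simp [ones, PiLp.inner_apply]

/-- The average of the cyclic shifts of `m` is the multiple of `𝟏` with the same coordinate sum;
it lies in every convex set containing these shifts. -/
theorem average_shifts_mem {n : ℕ} [NeZero n] {C : Set (EuclideanSpace ℝ (Fin n))}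
    (hC : Convex ℝ C) (m : Fin n → ℤ)
    (hm : ∀ j : Fin n, toReal (m ∘ Equiv.addLeft j) ∈ C) :
    ((∑ i, (m i : ℝ)) / n) • ones n ∈ C := by
  have hn : (n : ℝ) ≠ 0 := by exact_mod_cast NeZero.ne n
  have h := hC.sum_mem (t := Finset.univ) (w := fun _ : Fin n => (n : ℝ)⁻¹)
    (z := fun j => toReal (m ∘ Equiv.addLeft j)) (by intros; positivity)
    (by simp [hn]) (fun j _ => hm j)
  convert h using 1
  ext i
  simp only [toReal, ones, PiLp.smul_apply, smul_eq_mul, mul_one, WithLp.ofLp_sum,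
    Finset.sum_apply, Function.comp_apply, Equiv.coe_addLeft, ← Finset.mul_sum]
  rw [div_eq_inv_mul]
  congr 1
  exact (Equiv.sum_comp (Equiv.addRight i) fun l => (m l : ℝ)).symm

/-- A vertex of the form `k𝟏` strictly minimizes or strictly maximizes the coordinate sum on the
support: averages over cyclic shifts stay in the convex set `sNewt f \ {k𝟏}`. -/
theorem exists_sign_of_vertex {n : ℕ} [NeZero n] {f : GL (Fin n) ℂ → ℂ}
    (hf : IsRegularFunction f) {k : ℤ} (hv : (k : ℝ) • ones n ∈ vertices f) :
    ∃ ε : ℤ, (ε = 1 ∨ ε = -1) ∧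
      ∀ m ∈ support f, m ≠ (fun _ => k) → ε * (n * k) < ε * ∑ i, m i := by
  have hn : (0 : ℝ) < n := by exact_mod_cast NeZero.pos n
  set v := (k : ℝ) • ones n with hvdef
  have hC := ((convex_convexHull ℝ (toReal '' support f)).mem_extremePoints_iff_convex_sdiff.1
    hv).2
  have havg : ∀ m ∈ support f, m ≠ (fun _ => k) →
      ((∑ i, (m i : ℝ)) / n) • ones n ∈ sNewt f \ {v} := by
    intro m hm hmk
    refine average_shifts_mem hC m fun j => ⟨subset_convexHull ℝ _
      ⟨_, comp_perm_mem_support hf hm _, rfl⟩, fun h => hmk ?_⟩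
    funext i
    have h2 := congrArg (fun x : EuclideanSpace ℝ (Fin n) => x (-j + i)) h
    simp only [toReal, hvdef, ones, PiLp.smul_apply, smul_eq_mul, mul_one, Function.comp_apply,
      Equiv.coe_addLeft, add_neg_cancel_left] at h2
    exact_mod_cast h2
  have hne : ∀ m ∈ support f, m ≠ (fun _ => k) → (∑ i, m i) ≠ n * k := by
    intro m hm hmk h
    refine (havg m hm hmk).2 ?_
    have h' : (∑ i, (m i : ℝ)) = n * k := by exact_mod_cast h
    rw [h', hvdef, mul_div_cancel_left₀ _ hn.ne']
    rfl
  by_contra! hcon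
  obtain ⟨m, hm, hmk, h1⟩ := hcon 1 (Or.inl rfl)
  obtain ⟨m', hm', hmk', h2⟩ := hcon (-1) (Or.inr rfl)
  have h1' : (∑ i, (m i : ℝ)) < n * k := by
    have := lt_of_le_of_ne (by simpa using h1) (hne m hm hmk)
    exact_mod_cast this
  have h2' : (n * k : ℝ) < ∑ i, (m' i : ℝ) := by
    have := lt_of_le_of_ne (by simpa using h2) (hne m' hm' hmk').symm
    exact_mod_cast this
  set a := (∑ i, (m i : ℝ)) / n
  set b := (∑ i, (m' i : ℝ)) / n
  have ha : a < k := by rw [div_lt_iff₀ hn]; linarith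
  have hb : (k : ℝ) < b := by rw [lt_div_iff₀ hn]; linarith
  have hmem : v ∈ segment ℝ (a • ones n) (b • ones n) := by
    have : (k : ℝ) ∈ segment ℝ a b := by
      rw [segment_eq_Icc (ha.trans hb).le]; exact ⟨ha.le, hb.le⟩
    obtain ⟨s, t, hs, ht, hst, e⟩ := this
    refine ⟨s, t, hs, ht, hst, ?_⟩
    rw [hvdef, ← e, smul_smul, smul_smul, ← add_smul]
    rfl
  exact (hC.segment_subset (havg m hm hmk) (havg m' hm' hmk') hmem).2 rfl

theorem vertex_mem_support {n : ℕ} {f : GL (Fin n) ℂ → ℂ} {v : EuclideanSpace ℝ (Fin n)}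
    (hv : v ∈ vertices f) : ∃ m ∈ support f, toReal m = v := by
  have h : v ∈ toReal '' support f := extremePoints_convexHull_subset hv
  exact h

theorem toReal_const {n : ℕ} (k : ℤ) : toReal (fun _ : Fin n => k) = (k : ℝ) • ones n := by
  ext i; simp [toReal, ones]

theorem const_mem_support {n : ℕ} {f : GL (Fin n) ℂ → ℂ} {k : ℤ}
    (hv : (k : ℝ) • ones n ∈ vertices f) : (fun _ => k) ∈ support f := by
  obtain ⟨m, hm, e⟩ := vertex_mem_support hv
  convert hm
  rename_i i
  have := congrArg (fun x : EuclideanSpace ℝ (Fin n) => x i) e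
  simp only [toReal, ones, PiLp.smul_apply, smul_eq_mul, mul_one] at this
  exact_mod_cast this.symm

theorem sign_smul_ones_mem_normalCone {n : ℕ} {f : GL (Fin n) ℂ → ℂ} {k ε : ℤ}
    (h : ∀ m ∈ support f, m ≠ (fun _ => k) → ε * (n * k) < ε * ∑ i, m i) :
    (ε : ℝ) • ones n ∈ normalCone (sNewt f) {(k : ℝ) • ones n} := by
  rintro x rfl y hy
  have hle : ∀ z ∈ toReal '' support f, (ε * (n * k) : ℝ) ≤ inner ℝ ((ε : ℝ) • ones n) z := by
    rintro _ ⟨m, hm, rfl⟩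
    rw [real_inner_smul_left, inner_ones]
    by_cases hmk : m = fun _ => k
    · subst hmk
      simp [toReal]
    · have := (h m hm hmk).le
      simp only [toReal]
      exact_mod_cast this
  have hx : inner ℝ ((ε : ℝ) • ones n) ((k : ℝ) • ones n) = (ε * (n * k) : ℝ) := by
    rw [real_inner_smul_left, inner_ones]
    simp [ones]
  rw [hx]
  have hconv : Convex ℝ {z | (ε * (n * k) : ℝ) ≤ inner ℝ ((ε : ℝ) • ones n) z} :=
    convex_halfSpace_ge (innerₛₗ ℝ ((ε : ℝ) • ones n)).isLinear _
  exact convexHull_min hle hconv hy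

/-- At most one multiple of `𝟏` minimizes and at most one maximizes the coordinate sum. -/
theorem encard_vertices_inter_diagonalLattice_le {n : ℕ} [NeZero n] {f : GL (Fin n) ℂ → ℂ}
    (hf : IsRegularFunction f) : (vertices f ∩ diagonalLattice n).encard ≤ 2 := by
  have hn : (0 : ℤ) < n := by exact_mod_cast NeZero.pos n
  let S : ℤ → Set (EuclideanSpace ℝ (Fin n)) := fun ε =>
    {v | ∃ k : ℤ, v = (k : ℝ) • ones n ∧ v ∈ vertices f ∧
      ∀ m ∈ support f, m ≠ (fun _ => k) → ε * (n * k) < ε * ∑ i, m i}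
  have hsub : ∀ ε, (S ε).encard ≤ 1 := by
    intro ε
    rw [Set.encard_le_one_iff]
    rintro _ _ ⟨k, rfl, hkv, hk⟩ ⟨l, rfl, hlv, hl⟩
    by_contra hne
    have hkl : k ≠ l := fun h => hne (by rw [h])
    have h1 := hk _ (const_mem_support hlv) fun h => hkl (congrFun h 0).symm
    have h2 := hl _ (const_mem_support hkv) fun h => hkl (congrFun h 0)
    simp only [Finset.sum_const, Finset.card_univ, Fintype.card_fin, nsmul_eq_mul] at h1 h2
    exact lt_asymm h1 h2
  calc (vertices f ∩ diagonalLattice n).encard ≤ (S 1 ∪ S (-1)).encard := by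
        refine Set.encard_le_encard ?_
        rintro v ⟨hv, k, rfl⟩
        obtain ⟨ε, rfl | rfl, h⟩ := exists_sign_of_vertex hf hv
        · exact Or.inl ⟨k, rfl, hv, h⟩
        · exact Or.inr ⟨k, rfl, hv, h⟩
    _ ≤ (S 1).encard + (S (-1)).encard := Set.encard_union_le _ _
    _ ≤ 1 + 1 := add_le_add (hsub 1) (hsub (-1))
    _ = 2 := by norm_num

/-! ### The extreme homogeneous part of a regular function -/

/-- A property of elements of `GL_n` that is not affected by right translation with
diagonalizable matrices is not affected by any right translation, because a transvection is a
product of two diagonalizable matrices. -/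
theorem iff_of_diagonalizable_invariant {n : ℕ} {p : GL (Fin n) ℂ → Prop}
    (hp : ∀ (g B : GL (Fin n) ℂ) (z : Fin n → ℂˣ), p (g * (B * diagGL z * B⁻¹)) ↔ p g)
    (g h : GL (Fin n) ℂ) : p (g * h) ↔ p g := by
  have hdiag : ∀ (g : GL (Fin n) ℂ) (z : Fin n → ℂˣ), p (g * diagGL z) ↔ p g := by
    intro g z
    simpa using hp g 1 z
  suffices H : ∀ M : Matrix (Fin n) (Fin n) ℂ, M.det ≠ 0 →
      ∀ h : GL (Fin n) ℂ, (h : Matrix (Fin n) (Fin n) ℂ) = M → ∀ g, p (g * h) ↔ p g from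
    H h.1 (Matrix.isUnits_det_units h).ne_zero h rfl g
  intro M hM
  refine Matrix.diagonal_transvection_induction_of_det_ne_zero
    (fun M => ∀ h : GL (Fin n) ℂ, (h : Matrix (Fin n) (Fin n) ℂ) = M → ∀ g, p (g * h) ↔ p g)
    M hM ?_ ?_ ?_
  · intro D hD h hh g
    have hne : ∀ i, D i ≠ 0 := fun i h0 => hD (by
      rw [Matrix.det_diagonal]; exact Finset.prod_eq_zero (Finset.mem_univ i) h0)
    have : h = diagGL fun i => Units.mk0 (D i) (hne i) := Units.ext hh
    rw [this]
    exact hdiag _ _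
  · intro t h hh g
    obtain ⟨i, j, hij, c⟩ := t
    -- `T = B D B⁻¹ D⁻¹` for `D = diag(1, …, 2, …, 1)` and `B = T⁻¹`
    let z : Fin n → ℂˣ := Function.update 1 i (Units.mk0 2 two_ne_zero)
    have hmul : h * diagGL z = h⁻¹ * diagGL z * h⁻¹⁻¹ := by
      rw [inv_inv, mul_assoc, eq_inv_mul_iff_mul_eq]
      apply Units.ext
      simp only [Units.val_mul, hh, Matrix.TransvectionStruct.toMatrix_mk]
      have h1 : Matrix.transvection i j c * ((diagGL z : GL (Fin n) ℂ) : Matrix (Fin n) (Fin n) ℂ) =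
          (diagGL z : GL (Fin n) ℂ) + Matrix.single i j c := by
        rw [Matrix.transvection, add_mul, one_mul]
        congr 1
        ext a b
        simp only [diagGL, Matrix.mul_diagonal, Matrix.single_apply]
        by_cases hb : i = a ∧ j = b
        · obtain ⟨rfl, rfl⟩ := hb
          simp [z, hij.symm]
        · simp [hb]
      have h2 : ((diagGL z : GL (Fin n) ℂ) : Matrix (Fin n) (Fin n) ℂ) * Matrix.transvection i j c =
          (diagGL z : GL (Fin n) ℂ) + Matrix.single i j (2 * c) := by
        rw [Matrix.transvection, mul_add, mul_one]
        congr 1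
        ext a b
        simp only [diagGL, Matrix.diagonal_mul, Matrix.single_apply]
        by_cases hb : i = a ∧ j = b
        · obtain ⟨rfl, rfl⟩ := hb
          simp [z]
        · simp [hb]
      rw [h1, h2, mul_add, h1, add_assoc]
      congr 1
      rw [Matrix.transvection, add_mul, one_mul, Matrix.single_mul_single_of_ne _ _ _ _ hij.symm,
        add_zero, ← Matrix.single_add, two_mul]
    rw [← hdiag (g * h) z, mul_assoc, hmul]
    exact hp _ _ _
  · intro A B hA hB iA iB h hh g
    have e : h = Matrix.GeneralLinearGroup.mkOfDetNeZero A hA *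
        Matrix.GeneralLinearGroup.mkOfDetNeZero B hB := Units.ext hh
    rw [e, ← mul_assoc, iB _ rfl, iA _ rfl]

/-- The scalar matrix `τ`. -/
noncomputable def scalarGL (n : ℕ) (τ : ℂˣ) : GL (Fin n) ℂ := diagGL fun _ => τ

theorem coe_scalarGL {n : ℕ} (τ : ℂˣ) :
    (scalarGL n τ : Matrix (Fin n) (Fin n) ℂ) = Matrix.scalar (Fin n) (τ : ℂ) := rfl

theorem scalarGL_mul_comm {n : ℕ} (τ : ℂˣ) (g : GL (Fin n) ℂ) :
    scalarGL n τ * g = g * scalarGL n τ := by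
  apply Units.ext
  simp only [Units.val_mul, coe_scalarGL]
  exact (Matrix.scalar_commute _ (fun _ => Commute.all _ _) _).eq

theorem prod_zpow_eq_zpow_sum {ι : Type*} (s : Finset ι) {a : ℂ} (ha : a ≠ 0) (m : ι → ℤ) :
    ∏ i ∈ s, a ^ m i = a ^ ∑ i ∈ s, m i := by
  classical
  induction s using Finset.induction_on with
  | empty => simp
  | insert i s hi ih => rw [Finset.prod_insert hi, Finset.sum_insert hi, zpow_add₀ ha, ih]

/-- The expansion of `f` along the line through `g`: `f (τ g) = ∑ e, c e * τ ^ e`. -/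
def IsRadialExpansion {n : ℕ} (f : GL (Fin n) ℂ → ℂ) (g : GL (Fin n) ℂ) (c : ℤ →₀ ℂ) : Prop :=
  ∀ τ : ℂˣ, f (scalarGL n τ * g) = c.sum fun e a => a * (τ : ℂ) ^ e

theorem IsRadialExpansion.unique {n : ℕ} {f : GL (Fin n) ℂ → ℂ} {g : GL (Fin n) ℂ}
    {c d : ℤ →₀ ℂ} (hc : IsRadialExpansion f g c) (hd : IsRadialExpansion f g d) : c = d := by
  have hinj : Function.Injective fun (e : ℤ) (_ : Fin 1) => e := fun a b h => congrFun h 0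
  refine Finsupp.mapDomain_injective hinj (IsLaurentExpansion.unique
    (g := fun z : Fin 1 → ℂˣ => f (scalarGL n (z 0) * g)) (fun z => ?_) fun z => ?_)
  · rw [Finsupp.sum_mapDomain_index_inj hinj]
    refine (hc (z 0)).trans ?_
    simp [laurentMonomial]
  · rw [Finsupp.sum_mapDomain_index_inj hinj]
    refine (hd (z 0)).trans ?_
    simp [laurentMonomial]

theorem isRadialExpansion_of_Q {n : ℕ} {f : GL (Fin n) ℂ → ℂ} (hf : IsRegularFunction f)
    (A B : GL (Fin n) ℂ) (z : Fin n → ℂˣ) :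
    IsRadialExpansion f (A * diagGL z * B⁻¹) ((laurentCoeff (Psi f A B)).sum fun m a =>
      Finsupp.single (∑ i, m i) (a * laurentMonomial m z)) := by
  intro τ
  have e : scalarGL n τ * (A * diagGL z * B⁻¹) = A * diagGL (fun i => τ * z i) * B⁻¹ := by
    have hd : diagGL (fun i => τ * z i) = scalarGL n τ * diagGL z := by
      apply Units.ext
      simp [scalarGL, diagGL]
    rw [hd, ← mul_assoc, ← mul_assoc, scalarGL_mul_comm, mul_assoc A]
  rw [e, Finsupp.sum_sum_index (by simp) (by intros; ring)]
  refine (Q_spec hf A B _).trans (Finsupp.sum_congr fun m _ => ?_)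
  rw [Finsupp.sum_single_index (by simp)]
  simp only [laurentMonomial, Units.val_mul, mul_zpow, Finset.prod_mul_distrib]
  rw [prod_zpow_eq_zpow_sum _ τ.ne_zero]
  ring


theorem eval_mul_of_isHomogeneous {σ : Type*} {p : MvPolynomial σ ℂ} {j : ℕ}
    (hp : p.IsHomogeneous j) (t : ℂ) (x : σ → ℂ) :
    MvPolynomial.eval (fun i => t * x i) p = t ^ j * MvPolynomial.eval x p := by
  rw [MvPolynomial.eval_eq, MvPolynomial.eval_eq, Finset.mul_sum]
  refine Finset.sum_congr rfl fun d hd => ?_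
  have hdeg : ∑ i ∈ d.support, d i = j := by
    have := hp (MvPolynomial.mem_support_iff.1 hd)
    simpa [Finsupp.weight_apply, Finsupp.sum] using this
  simp only [mul_pow, Finset.prod_mul_distrib, Finset.prod_pow_eq_pow_sum, hdeg]
  ring

/-- The decomposition of a regular function into its homogeneous parts, which are regular. -/
theorem exists_homogeneous_decomposition {n : ℕ} {f : GL (Fin n) ℂ → ℂ}
    (hf : IsRegularFunction f) :
    ∃ (J : ℕ) (e : ℕ → ℤ) (c : ℕ → GL (Fin n) ℂ → ℂ), Function.Injective e ∧
      (∀ j, IsRegularFunction (c j)) ∧ ∀ g, IsRadialExpansion f g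
        (∑ j ∈ Finset.range J, Finsupp.single (e j) (c j g)) := by
  obtain ⟨N, P, hP⟩ := hf
  refine ⟨P.totalDegree + 1, fun j => n * N + j, fun j A =>
    (A : Matrix (Fin n) (Fin n) ℂ).det ^ N * MvPolynomial.eval
      (fun ij => (A : Matrix (Fin n) (Fin n) ℂ) ij.1 ij.2) (MvPolynomial.homogeneousComponent j P),
    fun a b h => by simpa using h, fun j => ⟨N, _, fun A => rfl⟩, fun g τ => ?_⟩
  have hval : ∀ i j, (scalarGL n τ * g : GL (Fin n) ℂ) i j =
      (τ : ℂ) * (g : Matrix (Fin n) (Fin n) ℂ) i j := by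
    intro i j
    simp [scalarGL, diagGL, Matrix.diagonal_mul]
  have hdet : ((scalarGL n τ * g : GL (Fin n) ℂ) : Matrix (Fin n) (Fin n) ℂ).det =
      (τ : ℂ) ^ n * (g : Matrix (Fin n) (Fin n) ℂ).det := by
    rw [Units.val_mul, Matrix.det_mul, coe_scalarGL]
    simp
  rw [hP, hdet]
  simp only [hval]
  conv_lhs => rw [← MvPolynomial.sum_homogeneousComponent P]
  rw [map_sum, ← Finsupp.sum_finsetSum_index (by simp) (by intros; ring), Finset.mul_sum]
  refine Finset.sum_congr rfl fun j _ => ?_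
  rw [Finsupp.sum_single_index (by simp),
    eval_mul_of_isHomogeneous (MvPolynomial.homogeneousComponent_isHomogeneous j P),
    zpow_add₀ τ.ne_zero, mul_zpow, _root_.zpow_mul, zpow_natCast, zpow_natCast]
  ring

/-- If `k𝟏` is the strict extremum of the coordinate sum on the support, then `f (τ ^ ε g)` is
`τ ^ (ε n k)` times a polynomial in `τ` whose value at `τ = 0` vanishes for no `g`. Indeed, this
value is `Q_{k𝟏}(A, B) det(diag z) ^ k` for every factorization `g = A diag(z) B⁻¹`, so that its
vanishing is not affected by right translation of `g` with `B diag(z) B⁻¹`. The coefficients of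
the polynomial are regular functions of `g`. -/
theorem exists_extreme_expansion {n : ℕ} {f : GL (Fin n) ℂ → ℂ} (hf : IsRegularFunction f)
    {k ε : ℤ} (hε : ε = 1 ∨ ε = -1) (hk : (fun _ => k) ∈ support f)
    (hmin : ∀ m ∈ support f, m ≠ (fun _ => k) → ε * (n * k) < ε * ∑ i, m i) :
    ∃ (J : ℕ) (a : ℕ → ℕ) (c : ℕ → GL (Fin n) ℂ → ℂ), (∀ j, IsRegularFunction (c j)) ∧
      (∀ g (τ : ℂˣ), f (scalarGL n (τ ^ ε) * g) =
        (τ : ℂ) ^ (ε * (n * k)) * ∑ j ∈ Finset.range J, c j g * (τ : ℂ) ^ a j) ∧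
      ∀ g, ∑ j ∈ Finset.range J, c j g * (0 : ℂ) ^ a j ≠ 0 := by
  obtain ⟨J, e, c, he, hc, hexp⟩ := exists_homogeneous_decomposition hf
  set r : GL (Fin n) ℂ → ℤ →₀ ℂ := fun g => ∑ j ∈ Finset.range J, Finsupp.single (e j) (c j g)
    with hr
  have hrval : ∀ g (A B : GL (Fin n) ℂ) (z : Fin n → ℂˣ), g = A * diagGL z * B⁻¹ → ∀ d : ℤ,
      r g d = (laurentCoeff (Psi f A B)).sum fun m a =>
        if ∑ i, m i = d then a * laurentMonomial m z else 0 := by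
    rintro _ A B z rfl d
    rw [hr]
    simp only
    rw [(hexp _).unique (isRadialExpansion_of_Q hf A B z), Finsupp.sum_apply]
    simp only [Finsupp.single_apply]
  have hsupp : ∀ A B m, m ∈ (laurentCoeff (Psi f A B)).support → m ∈ support f :=
    fun A B m hm => ⟨A, B, Finsupp.mem_support_iff.1 hm⟩
  have hlow : ∀ g d, ε * d < ε * (n * k) → r g d = 0 := by
    intro g d hd
    rw [hrval g g 1 1 (by simp [show diagGL (1 : Fin n → ℂˣ) = 1 from Units.ext (by
      ext; simp [diagGL])])]
    refine Finset.sum_eq_zero fun m hm => if_neg ?_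
    rintro rfl
    by_cases hmk : m = fun _ => k
    · subst hmk; simp at hd
    · exact lt_asymm hd (hmin m (hsupp _ _ _ hm) hmk)
  have hlead : ∀ g (A B : GL (Fin n) ℂ) (z : Fin n → ℂˣ), g = A * diagGL z * B⁻¹ →
      r g (n * k) = Q f (fun _ => k) A B * laurentMonomial (fun _ => k) z := by
    intro g A B z hg
    rw [hrval g A B z hg, Finsupp.sum, Finset.sum_eq_single (fun _ => k)]
    · simp [Q]
    · intro m hm hmk
      refine if_neg fun h => ?_
      have := hmin m (hsupp _ _ _ hm) hmk
      rw [h] at this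
      exact lt_irrefl _ this
    · intro h
      simp [Finsupp.notMem_support_iff.1 h]
  have hmono : ∀ z : Fin n → ℂˣ, laurentMonomial (fun _ => k) z ≠ 0 := fun z =>
    Finset.prod_ne_zero_iff.2 fun i _ => zpow_ne_zero _ (z i).ne_zero
  have hone : diagGL (1 : Fin n → ℂˣ) = 1 := Units.ext (by ext; simp [diagGL])
  have hinv : ∀ g h : GL (Fin n) ℂ, r (g * h) (n * k) ≠ 0 ↔ r g (n * k) ≠ 0 := by
    refine iff_of_diagonalizable_invariant (p := fun g => r g (n * k) ≠ 0) fun g B z => ?_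
    rw [hlead (g * (B * diagGL z * B⁻¹)) (g * B) B z (by group),
      hlead g (g * B) B 1 (by rw [hone]; group)]
    simp [hmono]
  have hne : ∀ g, r g (n * k) ≠ 0 := by
    obtain ⟨A, B, hAB⟩ := hk
    intro g
    have h1 : r (A * B⁻¹) (n * k) ≠ 0 := by
      rw [hlead _ A B 1 (by rw [hone, mul_one])]
      exact mul_ne_zero hAB (hmono _)
    have := (hinv (A * B⁻¹) (B * A⁻¹ * g)).2 h1
    rwa [show A * B⁻¹ * (B * A⁻¹ * g) = g by group] at this
  have hcr : ∀ g, ∀ j ∈ Finset.range J, r g (e j) = c j g := by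
    intro g j hj
    simp only [hr, Finsupp.finsetSum_apply, Finsupp.single_apply, he.eq_iff]
    simp [Finset.sum_ite_eq', Finset.mem_range.1 hj]
  refine ⟨J, fun j => (ε * e j - ε * (n * k)).toNat, c, hc, fun g τ => ?_, fun g => ?_⟩
  · rw [hexp g (τ ^ ε), ← Finsupp.sum_finsetSum_index (by simp) (by intros; ring),
      Finset.mul_sum]
    refine Finset.sum_congr rfl fun j hj => ?_
    rw [Finsupp.sum_single_index (by simp)]
    by_cases h0 : c j g = 0
    · simp [h0]
    have hle : 0 ≤ ε * e j - ε * (n * k) := by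
      by_contra! h
      exact h0 (by rw [← hcr g j hj]; exact hlow g _ (by linarith))
    rw [← zpow_natCast, Int.toNat_of_nonneg hle, mul_left_comm, ← zpow_add₀ τ.ne_zero,
      Units.val_zpow_eq_zpow_val, ← _root_.zpow_mul]
    congr 2
    ring
  · have : ∑ j ∈ Finset.range J, c j g * (0 : ℂ) ^ (ε * e j - ε * (n * k)).toNat =
        r g (n * k) := by
      simp only [hr, Finsupp.finsetSum_apply, Finsupp.single_apply]
      refine Finset.sum_congr rfl fun j hj => ?_
      split_ifs with h
      · simp [h]
      · by_cases h0 : c j g = 0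
        · simp [h0]
        have hle : 0 ≤ ε * e j - ε * (n * k) := by
          by_contra! h
          exact h0 (by rw [← hcr g j hj]; exact hlow g _ (by linarith))
        have hne' : ε * e j - ε * (n * k) ≠ 0 := by
          rcases hε with rfl | rfl <;> omega
        rw [zero_pow (by omega), mul_zero]
    rw [this]
    exact hne g

/-! ### The amoeba in terms of the orbits of the unitary group -/

theorem exists_perm_of_multiset_map_eq {ι α : Type*} [Fintype ι] {f g : ι → α}
    (h : Finset.univ.val.map f = Finset.univ.val.map g) :
    ∃ σ : Equiv.Perm ι, ∀ i, g (σ i) = f i := by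
  classical
  have hcard : ∀ a, Nonempty ({i // f i = a} ≃ {i // g i = a}) := by
    intro a
    rw [← Fintype.card_eq, Fintype.card_subtype, Fintype.card_subtype]
    have := congrArg (Multiset.count a) h
    simpa [Multiset.count_map, eq_comm, Finset.card_def, Finset.filter_val] using this
  exact ⟨Equiv.ofFiberEquiv fun a => (hcard a).some, fun i => Equiv.ofFiberEquiv_map _ i⟩

theorem coe_expDiag {n : ℕ} (x : EuclideanSpace ℝ (Fin n)) :
    (expDiag x : Matrix (Fin n) (Fin n) ℂ) = Matrix.diagonal fun i => Complex.exp (x i) := rfl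

/-- The singular values of `U exp(diag x) V^*` are the numbers `exp (x i)`: both families are the
square roots of the roots of the characteristic polynomial of `Aᴴ A`. -/
theorem exists_perm_sLog {n : ℕ} (x : EuclideanSpace ℝ (Fin n))
    (U V : Matrix.unitaryGroup (Fin n) ℂ) :
    ∃ σ : Equiv.Perm (Fin n), ∀ i,
      sLog (Unitary.toUnits U * expDiag x * Unitary.toUnits (star V)) (σ i) = x i := by
  set A : GL (Fin n) ℂ := Unitary.toUnits U * expDiag x * Unitary.toUnits (star V) with hA
  set T := Matrix.toEuclideanLin (A : Matrix (Fin n) (Fin n) ℂ) with hT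
  have hfin : Module.finrank ℂ (EuclideanSpace ℂ (Fin n)) = n := by simp
  have hAA : (A : Matrix (Fin n) (Fin n) ℂ)ᴴ * A =
      (V : Matrix (Fin n) (Fin n) ℂ) *
        (Matrix.diagonal (fun i => ((Real.exp (x i) ^ 2 : ℝ) : ℂ)) *
          star (V : Matrix (Fin n) (Fin n) ℂ)) := by
    have hU : star (U : Matrix (Fin n) (Fin n) ℂ) * (U : Matrix (Fin n) (Fin n) ℂ) = 1 :=
      Unitary.coe_star_mul_self U
    have hD : star (expDiag x : Matrix (Fin n) (Fin n) ℂ) * (expDiag x : Matrix (Fin n) (Fin n) ℂ) =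
        Matrix.diagonal (fun i => ((Real.exp (x i) ^ 2 : ℝ) : ℂ)) := by
      rw [coe_expDiag, Matrix.star_eq_conjTranspose, Matrix.diagonal_conjTranspose,
        Matrix.diagonal_mul_diagonal]
      congr 1
      funext i
      simp [← Complex.exp_conj, sq]
    have hval : (A : Matrix (Fin n) (Fin n) ℂ) = (U : Matrix (Fin n) (Fin n) ℂ) *
        (expDiag x : Matrix (Fin n) (Fin n) ℂ) * star (V : Matrix (Fin n) (Fin n) ℂ) := by
      simp [hA]
    rw [← Matrix.star_eq_conjTranspose, hval, star_mul, star_mul, star_star, ← hD]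
    simp only [mul_assoc]
    rw [← mul_assoc (star (U : Matrix (Fin n) (Fin n) ℂ)), hU, one_mul]
  have hchar : (LinearMap.adjoint T ∘ₗ T).charpoly =
      ∏ i, (Polynomial.X - Polynomial.C ((Real.exp (x i) ^ 2 : ℝ) : ℂ)) := by
    have h1 : LinearMap.adjoint T ∘ₗ T =
        Matrix.toLin (EuclideanSpace.basisFun (Fin n) ℂ).toBasis
          (EuclideanSpace.basisFun (Fin n) ℂ).toBasis ((A : Matrix (Fin n) (Fin n) ℂ)ᴴ * A) := by
      rw [hT, ← Matrix.toEuclideanLin_conjTranspose_eq_adjoint, Matrix.toLin_mul _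
        (EuclideanSpace.basisFun (Fin n) ℂ).toBasis, Matrix.toEuclideanLin_eq_toLin_orthonormal]
    rw [h1, Matrix.charpoly_toLin, hAA, Matrix.charpoly_mul_comm, mul_assoc]
    rw [show star (V : Matrix (Fin n) (Fin n) ℂ) * (V : Matrix (Fin n) (Fin n) ℂ) = 1 from
      Unitary.coe_star_mul_self V, mul_one, Matrix.charpoly_diagonal]
  have hroots := T.isSymmetric_adjoint_comp_self.roots_charpoly_eq_eigenvalues hfin
  rw [hchar, Polynomial.roots_prod _ _ 
    (Finset.prod_ne_zero_iff.2 fun i _ => Polynomial.X_sub_C_ne_zero _)] at hroots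
  simp only [Polynomial.roots_X_sub_C, Multiset.bind_singleton] at hroots
  obtain ⟨σ, hσ⟩ := exists_perm_of_multiset_map_eq hroots
  refine ⟨σ, fun i => ?_⟩
  have h2 : T.isSymmetric_adjoint_comp_self.eigenvalues hfin (σ i) = Real.exp (x i) ^ 2 := by
    have := hσ i
    simp only [Function.comp_apply] at this
    exact Complex.ofReal_injective this
  change Real.log (T.singularValues (σ i)) = x i
  rw [T.singularValues_fin hfin, h2, Real.sqrt_sq (Real.exp_pos _).le, Real.log_exp]

theorem toUnits_star {n : ℕ} (V : Matrix.unitaryGroup (Fin n) ℂ) :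
    Unitary.toUnits (star V) = (Unitary.toUnits V)⁻¹ := by
  rw [← map_inv]
  rfl

open scoped ComplexOrder in
/-- The singular value decomposition of an invertible matrix. -/
theorem exists_eq_unitary_mul_expDiag_mul_unitary {n : ℕ} (A : GL (Fin n) ℂ) :
    ∃ (y : EuclideanSpace ℝ (Fin n)) (U V : Matrix.unitaryGroup (Fin n) ℂ),
      A = Unitary.toUnits U * expDiag y * Unitary.toUnits (star V) := by
  have hpos : ((A : Matrix (Fin n) (Fin n) ℂ)ᴴ * A).PosDef :=
    Matrix.PosDef.conjTranspose_mul_self _ (Matrix.mulVec_injective_of_isUnit A.isUnit)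
  set H := hpos.isHermitian
  set V := H.eigenvectorUnitary
  set y : EuclideanSpace ℝ (Fin n) := WithLp.toLp 2 fun i => Real.log (H.eigenvalues i) / 2 with hy
  have hspec : star (V : Matrix (Fin n) (Fin n) ℂ) * ((A : Matrix (Fin n) (Fin n) ℂ)ᴴ * A) * V =
      Matrix.diagonal (fun i => (H.eigenvalues i : ℂ)) := by
    have := H.conjStarAlgAut_star_eigenvectorUnitary
    rw [Unitary.conjStarAlgAut_star_apply] at this
    exact this
  have hU : ((A * Unitary.toUnits V * (expDiag y)⁻¹ : GL (Fin n) ℂ) : Matrix (Fin n) (Fin n) ℂ) ∈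
      Matrix.unitaryGroup (Fin n) ℂ := by
    rw [Matrix.mem_unitaryGroup_iff', Units.val_mul, Units.val_mul]
    set D := (((expDiag y)⁻¹ : GL (Fin n) ℂ) : Matrix (Fin n) (Fin n) ℂ) with hDdef
    have hD : D = Matrix.diagonal fun i => (Complex.exp (y i))⁻¹ := by
      rw [hDdef, expDiag]
      change Matrix.diagonal _ = _
      simp
    have hval : ((Unitary.toUnits V : GL (Fin n) ℂ) : Matrix (Fin n) (Fin n) ℂ) = V := rfl
    rw [hval, star_mul, star_mul]
    have e : star D * (star (V : Matrix (Fin n) (Fin n) ℂ) * star (A : Matrix (Fin n) (Fin n) ℂ)) *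
        ((A : Matrix (Fin n) (Fin n) ℂ) * V * D) = star D *
        (star (V : Matrix (Fin n) (Fin n) ℂ) * ((A : Matrix (Fin n) (Fin n) ℂ)ᴴ * A) * V) * D := by
      simp only [mul_assoc, Matrix.star_eq_conjTranspose]
    rw [e, hspec, hD, Matrix.star_eq_conjTranspose, Matrix.diagonal_conjTranspose,
      Matrix.diagonal_mul_diagonal, Matrix.diagonal_mul_diagonal, ← Matrix.diagonal_one]
    congr 1
    funext i
    have h1 : ((H.eigenvalues i : ℝ) : ℂ) = Complex.exp (y i) * Complex.exp (y i) := by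
      rw [← Complex.exp_add, ← Complex.ofReal_add, ← Complex.ofReal_exp]
      congr 1
      simp only [hy, add_halves]
      exact (Real.exp_log (hpos.eigenvalues_pos i)).symm
    have h2 : star ((Complex.exp (y i))⁻¹) = (Complex.exp (y i))⁻¹ := by
      simp [← Complex.exp_conj]
    simp only [Pi.star_apply, h2, h1]
    field_simp [Complex.exp_ne_zero]
  refine ⟨y, ⟨_, hU⟩, V, ?_⟩
  have e : Unitary.toUnits (⟨_, hU⟩ : Matrix.unitaryGroup (Fin n) ℂ) =
      A * Unitary.toUnits V * (expDiag y)⁻¹ := Units.ext rfl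
  rw [e, toUnits_star]
  group

/-- The amoeba consists of the points `x` for which `f` vanishes somewhere on the double coset
`U(n) exp(diag x) U(n)`. -/
theorem mem_amoeba_iff {n : ℕ} {f : GL (Fin n) ℂ → ℂ} {x : EuclideanSpace ℝ (Fin n)} :
    x ∈ amoeba f ↔ ∃ p, orbitValue f x p = 0 := by
  constructor
  · rintro ⟨A, hA, σ, hσ⟩
    obtain ⟨y, U, V, rfl⟩ := exists_eq_unitary_mul_expDiag_mul_unitary A
    obtain ⟨τ, hτ⟩ := exists_perm_sLog y U V
    have hxy : ∀ i, x i = y ((σ.trans τ.symm) i) := by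
      intro i
      rw [hσ, ← hτ]
      simp
    set P := permU (σ.trans τ.symm)
    refine ⟨(U * star P, V * star P), ?_⟩
    have hz := permU_mul_diagGL (σ.trans τ.symm) fun i =>
      Units.mk0 (Complex.exp (y i)) (Complex.exp_ne_zero _)
    have hx : expDiag x = Unitary.toUnits P * expDiag y * (Unitary.toUnits P)⁻¹ := by
      rw [eq_mul_inv_iff_mul_eq]
      refine Eq.trans ?_ hz.symm
      congr 1
      refine congrArg diagGL (funext fun i => Units.ext ?_)
      simp [hxy i]
    rw [← hA, orbitValue, hx]
    congr 1
    simp only [star_mul, star_star, map_mul, toUnits_star]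
    group
  · rintro ⟨⟨U, V⟩, h⟩
    obtain ⟨σ, hσ⟩ := exists_perm_sLog x U V
    exact ⟨_, h, σ, fun i => (hσ i).symm⟩

theorem notMem_amoeba_iff {n : ℕ} {f : GL (Fin n) ℂ → ℂ} {x : EuclideanSpace ℝ (Fin n)} :
    x ∉ amoeba f ↔ ∀ p, orbitValue f x p ≠ 0 := by
  rw [mem_amoeba_iff, not_exists]

/-! ### Circle means of the logarithm of a one-variable Laurent polynomial -/

open Real in
theorem circleAverage_log_norm_sub_of_norm_lt {a : ℂ} {r : ℝ} (hr : 0 < r) (ha : ‖a‖ < r) :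
    circleAverage (fun z => Real.log ‖z - a‖) 0 r = Real.log r := by
  refine circleAverage_log_norm_sub_const_of_mem_closedBall ?_
  simpa [abs_of_pos hr] using ha.le

open Real in
theorem circleAverage_log_norm_sub_of_lt_norm {a : ℂ} {r : ℝ} (hr : 0 < r) (ha : r < ‖a‖) :
    circleAverage (fun z => Real.log ‖z - a‖) 0 r = Real.log ‖a‖ := by
  have hapos : 0 < ‖a‖ := hr.trans ha
  have h := circleAverage_log_norm_sub_const_eq_log_radius_add_posLog (a := a) (c := 0) hr.ne'
  have h1 : 1 ≤ |r⁻¹ * ‖(0 : ℂ) - a‖| := by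
    rw [zero_sub, norm_neg, abs_of_pos (by positivity), inv_mul_eq_div, one_le_div hr]
    exact ha.le
  rw [posLog_eq_log h1, zero_sub, norm_neg, Real.log_mul (by positivity) hapos.ne',
    Real.log_inv] at h
  rw [h]; ring

open Real Polynomial in
/-- The mean of `log ‖P‖` over a circle without zeros of `P`, from the factorization of `P`. -/
theorem circleAverage_log_norm_polynomial (P : ℂ[X]) (hP : P ≠ 0) {r : ℝ} (hr : 0 < r)
    (hroot : ∀ a ∈ P.roots, ‖a‖ ≠ r) :
    circleAverage (fun z => Real.log ‖P.eval z‖) 0 r = Real.log ‖P.leadingCoeff‖ +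
      (P.roots.map fun a => if ‖a‖ < r then Real.log r else Real.log ‖a‖).sum := by
  have key : ∀ s : Multiset ℂ, (∀ a ∈ s, ‖a‖ ≠ r) →
      circleAverage (fun z => (s.map fun a => Real.log ‖z - a‖).sum) 0 r =
        (s.map fun a => if ‖a‖ < r then Real.log r else Real.log ‖a‖).sum ∧
      CircleIntegrable (fun z => (s.map fun a => Real.log ‖z - a‖).sum) 0 r := by
    intro s
    induction s using Multiset.induction_on with
    | empty => intro _; simp [circleAverage_const]
    | cons a s ih =>
      intro hs
      obtain ⟨ih1, ih2⟩ := ih fun b hb => hs b (Multiset.mem_cons_of_mem hb)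
      have hi : CircleIntegrable (fun z => Real.log ‖z - a‖) 0 r :=
        MeromorphicOn.circleIntegrable_log_norm (fun _ _ => by fun_prop)
      simp only [Multiset.map_cons, Multiset.sum_cons]
      refine ⟨?_, hi.add ih2⟩
      rw [← ih1]
      have := circleAverage_add hi ih2
      rw [Pi.add_def] at this
      rw [this]
      congr 1
      split_ifs with h
      · exact circleAverage_log_norm_sub_of_norm_lt hr h
      · exact circleAverage_log_norm_sub_of_lt_norm hr
          (lt_of_le_of_ne (not_lt.1 h) (hs a (Multiset.mem_cons_self a s)).symm)
  obtain ⟨h1, h2⟩ := key P.roots hroot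
  have hsplit := IsAlgClosed.splits P
  have heq : Set.EqOn (fun z => Real.log ‖P.eval z‖)
      (fun z => Real.log ‖P.leadingCoeff‖ + (P.roots.map fun a => Real.log ‖z - a‖).sum)
      (Metric.sphere 0 |r|) := by
    intro z hz
    have hz' : ‖z‖ = r := by simpa [abs_of_pos hr] using hz
    have hne : ∀ a ∈ P.roots, z - a ≠ 0 := fun a ha h => hroot a ha (by
      rw [← sub_eq_zero.1 h, hz'])
    have hprod : ∀ s : Multiset ℂ, (∀ a ∈ s, z - a ≠ 0) →
        Real.log ‖(s.map fun a => z - a).prod‖ = (s.map fun a => Real.log ‖z - a‖).sum := by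
      intro s
      induction s using Multiset.induction_on with
      | empty => simp
      | cons a s ih =>
        intro hs
        have h0 : (s.map fun a => z - a).prod ≠ 0 := by
          refine Multiset.prod_ne_zero fun h => ?_
          obtain ⟨b, hb, e⟩ := Multiset.mem_map.1 h
          exact hs b (Multiset.mem_cons_of_mem hb) e
        rw [Multiset.map_cons, Multiset.map_cons, Multiset.prod_cons, Multiset.sum_cons, norm_mul,
          Real.log_mul (norm_ne_zero_iff.2 (hs a (Multiset.mem_cons_self a s)))
            (norm_ne_zero_iff.2 h0), ih fun b hb => hs b (Multiset.mem_cons_of_mem hb)]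
    have hev : P.eval z = P.leadingCoeff * (P.roots.map fun a => z - a).prod := by
      conv_lhs => rw [hsplit.eq_prod_roots]
      simp [Polynomial.eval_multiset_prod, Multiset.map_map]
    have h0 : (P.roots.map fun a => z - a).prod ≠ 0 := by
      refine Multiset.prod_ne_zero fun h => ?_
      obtain ⟨b, hb, e⟩ := Multiset.mem_map.1 h
      exact hne b hb e
    simp only
    rw [hev, norm_mul, Real.log_mul (by simpa using hP) (norm_ne_zero_iff.2 h0), hprod _ hne]
  rw [circleAverage_congr_sphere heq, ← h1]
  have := circleAverage_add (circleIntegrable_const (Real.log ‖P.leadingCoeff‖) 0 r) h2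
  rw [Pi.add_def] at this
  rw [this, circleAverage_const]

/-- The mean of `log ‖q (h + iθ)‖` over `θ ∈ [0, 2π]`. For `q` a function of `τ = exp ζ`, this is
the mean over the circle of radius `exp h` in the variable `τ`. -/
noncomputable def logMean (q : ℂ → ℂ) (h : ℝ) : ℝ :=
  (2 * Real.pi)⁻¹ * ∫ θ in (0 : ℝ)..2 * Real.pi, Real.log ‖q (h + θ * Complex.I)‖

open Real Polynomial in
/-- Jensen's formula for a Laurent polynomial `τ ^ d * P τ` without zeros in an annulus around the
unit circle: the logarithmic mean is affine in the logarithm of the radius, and the slope is the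
number of zeros in the unit disc, counted with the order `d` at the origin. -/
theorem exists_logMean_slope (P : ℂ[X]) (d : ℤ) {q : ℂ → ℂ}
    (hq : ∀ ζ, q ζ = Complex.exp ζ ^ d * P.eval (Complex.exp ζ)) {δ : ℝ} (hδ : 0 < δ)
    (hne : ∀ h : ℝ, |h| < δ → ∀ θ : ℝ, q (h + θ * Complex.I) ≠ 0) :
    ∃ N : ℕ, (∀ h : ℝ, |h| < δ → logMean q h = logMean q 0 + h * ((d + N : ℤ) : ℝ)) ∧
      (N = 0 ↔ ∀ a : ℂ, ‖a‖ < 1 → P.eval a ≠ 0) := by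
  have hP : P ≠ 0 := by
    rintro rfl
    apply hne 0 (by simpa using hδ) 0
    rw [hq]; simp
  -- the moduli of the roots avoid the annulus
  have hroot : ∀ a ∈ P.roots, ∀ h : ℝ, |h| < δ → ‖a‖ ≠ Real.exp h := by
    intro a ha h hh e
    have ha0 : a ≠ 0 := by
      intro h0; rw [h0, norm_zero] at e; exact (Real.exp_pos h).ne e
    apply hne h hh a.arg
    have hexp : Complex.exp (h + a.arg * Complex.I) = a := by
      rw [Complex.exp_add, ← Complex.ofReal_exp, ← e, Complex.norm_mul_exp_arg_mul_I]
    rw [hq, hexp, (Polynomial.mem_roots hP).1 ha, mul_zero]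
  have hcut : ∀ a ∈ P.roots, ∀ h : ℝ, |h| < δ → (‖a‖ < Real.exp h ↔ ‖a‖ < 1) := by
    intro a ha h hh
    have hpath : ∀ t : ℝ, |t| < δ → ‖a‖ ≠ Real.exp t := hroot a ha
    rcases eq_or_ne a 0 with rfl | ha0
    · simp [Real.exp_pos]
    have hapos : 0 < ‖a‖ := norm_pos_iff.2 ha0
    have hlog : δ ≤ |Real.log ‖a‖| := by
      by_contra! hlt
      exact hpath _ hlt (Real.exp_log hapos).symm
    rw [← Real.log_lt_iff_lt_exp hapos, ← Real.log_neg_iff hapos]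
    rw [abs_lt] at hh
    rcases le_abs.1 hlog with hl | hl <;> constructor <;> intro <;> linarith
  have hmean : ∀ h : ℝ, |h| < δ → logMean q h = h * d + Real.log ‖P.leadingCoeff‖ +
      (P.roots.map fun a => if ‖a‖ < 1 then h else Real.log ‖a‖).sum := by
    intro h hh
    have hr := Real.exp_pos h
    have e1 : ∀ θ : ℝ, Real.log ‖q (h + θ * Complex.I)‖ =
        h * d + Real.log ‖P.eval (circleMap 0 (Real.exp h) θ)‖ := by
      intro θ
      have hcm : circleMap 0 (Real.exp h) θ = Complex.exp (h + θ * Complex.I) := by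
        simp [circleMap, Complex.exp_add]
      have h0 := hne h hh θ
      rw [hq] at h0 ⊢
      rw [hcm, norm_mul, Real.log_mul (norm_ne_zero_iff.2 (left_ne_zero_of_mul h0))
        (norm_ne_zero_iff.2 (right_ne_zero_of_mul h0)), norm_zpow, Real.log_zpow,
        Complex.norm_exp]
      simp [mul_comm]
    have e2 : logMean q h = circleAverage (fun z => h * d + Real.log ‖P.eval z‖) 0 (Real.exp h) := by
      rw [logMean, circleAverage, smul_eq_mul]
      congr 1
      exact intervalIntegral.integral_congr fun θ _ => e1 θ
    have hi : CircleIntegrable (fun z => Real.log ‖P.eval z‖) 0 (Real.exp h) :=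
      MeromorphicOn.circleIntegrable_log_norm (fun z _ =>
        (P.differentiable.analyticAt z).meromorphicAt)
    have := circleAverage_add (circleIntegrable_const (h * (d : ℝ)) 0 (Real.exp h)) hi
    rw [Pi.add_def] at this
    rw [e2, this, circleAverage_const, circleAverage_log_norm_polynomial P hP hr
      (fun a ha => hroot a ha h hh), ← add_assoc]
    congr 2
    refine Multiset.map_congr rfl fun a ha => ?_
    simp only [hcut a ha h hh, Real.log_exp]
  refine ⟨(P.roots.filter fun a => ‖a‖ < 1).card, ?_, ?_⟩
  · intro h hh
    rw [hmean h hh, hmean 0 (by simpa using hδ)]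
    have : ∀ s : Multiset ℂ, (s.map fun a => if ‖a‖ < 1 then h else Real.log ‖a‖).sum =
        (s.map fun a => if ‖a‖ < 1 then (0 : ℝ) else Real.log ‖a‖).sum +
          h * (s.filter fun a => ‖a‖ < 1).card := by
      intro s
      induction s using Multiset.induction_on with
      | empty => simp
      | cons a s ih =>
        by_cases ha : ‖a‖ < 1
        · simp [ha, ih]; ring
        · simp [ha, ih]; ring
    rw [this]
    push_cast
    ring
  · rw [Multiset.card_eq_zero, Multiset.filter_eq_nil]
    refine ⟨fun h a ha h0 => h a ((Polynomial.mem_roots hP).2 h0) ha, fun h a ha h1 => ?_⟩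
    exact h a h1 ((Polynomial.mem_roots hP).1 ha)

/-! ### Haar measure on the unitary group -/

instance unitarySecondCountable (n : ℕ) :
    SecondCountableTopology (Matrix.unitaryGroup (Fin n) ℂ) := by
  have : SecondCountableTopology (Matrix (Fin n) (Fin n) ℂ) :=
    inferInstanceAs (SecondCountableTopology (Fin n → Fin n → ℂ))
  exact Topology.IsEmbedding.subtypeVal.secondCountableTopology

theorem haarU_univ (n : ℕ) : haarU n Set.univ = 1 :=
  Measure.haarMeasure_self (K₀ := (⊤ : TopologicalSpace.PositiveCompacts _))

instance haarU_isProbabilityMeasure (n : ℕ) : IsProbabilityMeasure (haarU n) :=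
  ⟨haarU_univ n⟩

instance haarU_isHaarMeasure (n : ℕ) : (haarU n).IsHaarMeasure :=
  inferInstanceAs (Measure.haarMeasure _).IsHaarMeasure

/-- Compact groups are unimodular. -/
instance haarU_isMulRightInvariant (n : ℕ) : (haarU n).IsMulRightInvariant := by
  refine ⟨fun g => ?_⟩
  have hprob : IsProbabilityMeasure (Measure.map (· * g) (haarU n)) :=
    Measure.isProbabilityMeasure_map (measurable_mul_const g).aemeasurable
  have h := Measure.haarMeasure_unique (Measure.map (· * g) (haarU n)) ⊤
  rw [TopologicalSpace.PositiveCompacts.coe_top, measure_univ, one_smul] at h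
  exact h

/-- The product of the Haar probability measures on `U(n) × U(n)`. -/
noncomputable abbrev haarUU (n : ℕ) :
    Measure (Matrix.unitaryGroup (Fin n) ℂ × Matrix.unitaryGroup (Fin n) ℂ) :=
  (haarU n).prod (haarU n)

theorem integrable_of_continuous {n : ℕ}
    {F : Matrix.unitaryGroup (Fin n) ℂ × Matrix.unitaryGroup (Fin n) ℂ → ℝ} (hF : Continuous F) :
    Integrable F (haarUU n) :=
  hF.integrable_of_hasCompactSupport (HasCompactSupport.of_compactSpace F)

theorem integral_mul_right_fst {n : ℕ} (g : Matrix.unitaryGroup (Fin n) ℂ)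
    (F : Matrix.unitaryGroup (Fin n) ℂ × Matrix.unitaryGroup (Fin n) ℂ → ℝ) :
    ∫ p, F (p.1 * g, p.2) ∂haarUU n = ∫ p, F p ∂haarUU n := by
  have := integral_mul_right_eq_self (μ := haarUU n) F (g, 1)
  simpa [Prod.mul_def] using this

/-! ### Complexified torus orbits -/

theorem IsRegularFunction.continuous_comp {n : ℕ} {f : GL (Fin n) ℂ → ℂ}
    (hf : IsRegularFunction f) {X : Type*} [TopologicalSpace X] {g : X → GL (Fin n) ℂ}
    (hg : Continuous fun x => (g x : Matrix (Fin n) (Fin n) ℂ)) : Continuous fun x => f (g x) := by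
  obtain ⟨N, P, hP⟩ := hf
  simp only [hP]
  refine Continuous.mul ?_ ?_
  · exact hg.matrix_det.zpow₀ N fun x => Or.inl (Matrix.isUnits_det_units (g x)).ne_zero
  · refine (MvPolynomial.continuous_eval P).comp (continuous_pi fun ij => ?_)
    exact (continuous_apply_apply ij.1 ij.2).comp hg

/-- The diagonal matrix `exp(diag ζ)` for a complex vector `ζ`. -/
noncomputable def expGL {n : ℕ} (ζ : Fin n → ℂ) : GL (Fin n) ℂ :=
  diagGL fun i => Units.mk0 (Complex.exp (ζ i)) (Complex.exp_ne_zero _)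

theorem coe_expGL {n : ℕ} (ζ : Fin n → ℂ) :
    (expGL ζ : Matrix (Fin n) (Fin n) ℂ) = Matrix.diagonal fun i => Complex.exp (ζ i) := rfl

theorem expGL_add {n : ℕ} (ζ ξ : Fin n → ℂ) : expGL (ζ + ξ) = expGL ζ * expGL ξ := by
  apply Units.ext
  simp [coe_expGL, Matrix.diagonal_mul_diagonal, Complex.exp_add]

theorem expDiag_eq_expGL {n : ℕ} (x : EuclideanSpace ℝ (Fin n)) :
    expDiag x = expGL fun i => (x i : ℂ) := rfl

/-- The diagonal unitary matrix with phases `θ`. -/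
noncomputable def phaseU {n : ℕ} (θ : Fin n → ℝ) : Matrix.unitaryGroup (Fin n) ℂ :=
  ⟨Matrix.diagonal fun i => Complex.exp (θ i * Complex.I), by
    rw [Matrix.mem_unitaryGroup_iff, Matrix.star_eq_conjTranspose, Matrix.diagonal_conjTranspose,
      Matrix.diagonal_mul_diagonal, ← Matrix.diagonal_one]
    congr 1
    funext i
    simp [← Complex.exp_conj, ← Complex.exp_add]⟩

theorem toUnits_phaseU {n : ℕ} (θ : Fin n → ℝ) :
    Unitary.toUnits (phaseU θ) = expGL fun i => (θ i * Complex.I) := Units.ext rfl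

/-- The value `f (U exp(ζ diag b) W exp(diag y) V^*)`, as a function of the complex number `ζ`. The
extra unitary factor `W` is `1` for the Ronkin function; letting it vary makes it possible to
deform one coordinate direction `b` into another. -/
noncomputable def orbitLine {n : ℕ} (f : GL (Fin n) ℂ → ℂ) (b : Fin n → ℤ)
    (y : EuclideanSpace ℝ (Fin n)) (U W V : Matrix.unitaryGroup (Fin n) ℂ) (ζ : ℂ) : ℂ :=
  f (Unitary.toUnits U * expGL (fun i => b i * ζ) * Unitary.toUnits W * expDiag y *
    Unitary.toUnits (star V))

theorem continuous_orbitLine {n : ℕ} {f : GL (Fin n) ℂ → ℂ} (hf : IsRegularFunction f)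
    (b : Fin n → ℤ) {X : Type*} [TopologicalSpace X] {y : X → EuclideanSpace ℝ (Fin n)}
    {U W V : X → Matrix.unitaryGroup (Fin n) ℂ} {ζ : X → ℂ} (hy : Continuous y)
    (hU : Continuous U) (hW : Continuous W) (hV : Continuous V) (hζ : Continuous ζ) :
    Continuous fun x => orbitLine f b (y x) (U x) (W x) (V x) (ζ x) := by
  refine hf.continuous_comp ?_
  simp only [Units.val_mul, coe_expGL, coe_expDiag, Unitary.val_toUnits_apply, Unitary.coe_star]
  have h1 : ∀ i, Continuous fun x => y x i := fun i => by fun_prop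
  have h2 : Continuous fun x => (Matrix.diagonal fun i => Complex.exp (b i * ζ x) :
      Matrix (Fin n) (Fin n) ℂ) := Continuous.matrix_diagonal (by fun_prop)
  have h3 : Continuous fun x => (Matrix.diagonal fun i => Complex.exp (y x i) :
      Matrix (Fin n) (Fin n) ℂ) := Continuous.matrix_diagonal (by fun_prop)
  exact ((((continuous_subtype_val.comp hU).mul h2).mul (continuous_subtype_val.comp hW)).mul
    h3).mul (continuous_subtype_val.comp hV).star

theorem orbitLine_add_mul_I {n : ℕ} (f : GL (Fin n) ℂ → ℂ) (b : Fin n → ℤ)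
    (y : EuclideanSpace ℝ (Fin n)) (U W V : Matrix.unitaryGroup (Fin n) ℂ) (ζ : ℂ) (θ : ℝ) :
    orbitLine f b y U W V (ζ + θ * Complex.I) =
      orbitLine f b y (U * phaseU fun i => b i * θ) W V ζ := by
  unfold orbitLine
  rw [map_mul, toUnits_phaseU, mul_assoc _ (expGL _) (expGL _), ← expGL_add]
  congr 6
  funext i
  simp only [Pi.add_apply]
  push_cast
  ring

theorem orbitLine_one {n : ℕ} (f : GL (Fin n) ℂ → ℂ) (b : Fin n → ℤ)
    (y : EuclideanSpace ℝ (Fin n)) (U V : Matrix.unitaryGroup (Fin n) ℂ) (h : ℝ) :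
    orbitLine f b y U 1 V h = orbitValue f (y + h • toReal b) (U, V) := by
  unfold orbitLine orbitValue
  rw [map_one, mul_one, expDiag_eq_expGL, expDiag_eq_expGL, mul_assoc _ (expGL _) (expGL _),
    ← expGL_add]
  congr 5
  funext i
  simp [toReal]
  ring

theorem orbitLine_zero {n : ℕ} (f : GL (Fin n) ℂ → ℂ) (b : Fin n → ℤ)
    (y : EuclideanSpace ℝ (Fin n)) (U W V : Matrix.unitaryGroup (Fin n) ℂ) :
    orbitLine f b y U W V 0 = orbitValue f y (U * W, V) := by
  unfold orbitLine orbitValue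
  have : expGL (fun i => (b i : ℂ) * 0) = (1 : GL (Fin n) ℂ) := by
    apply Units.ext
    simp [coe_expGL]
  rw [this, mul_one, map_mul]

/-- Along an integral direction, `orbitLine` is a Laurent polynomial in `exp ζ`. -/
theorem exists_polynomial_orbitLine {n : ℕ} {f : GL (Fin n) ℂ → ℂ} (hf : IsRegularFunction f)
    (b : Fin n → ℤ) (y : EuclideanSpace ℝ (Fin n)) (U W V : Matrix.unitaryGroup (Fin n) ℂ) :
    ∃ (d : ℤ) (P : Polynomial ℂ), ∀ ζ,
      orbitLine f b y U W V ζ = Complex.exp ζ ^ d * P.eval (Complex.exp ζ) := by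
  set B : GL (Fin n) ℂ := (Unitary.toUnits W * expDiag y * Unitary.toUnits (star V))⁻¹
  set c := laurentCoeff (Psi f (Unitary.toUnits U) B)
  set M : ℤ := ∑ m ∈ c.support, |∑ i, b i * m i|
  refine ⟨-M, ∑ m ∈ c.support, Polynomial.C (c m) * Polynomial.X ^ ((∑ i, b i * m i) + M).toNat,
    fun ζ => ?_⟩
  have hexp := Complex.exp_ne_zero ζ
  have h1 : orbitLine f b y U W V ζ = Psi f (Unitary.toUnits U) B
      fun i => Units.mk0 (Complex.exp (b i * ζ)) (Complex.exp_ne_zero _) := by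
    unfold orbitLine Psi
    congr 1
    simp only [B, inv_inv, mul_assoc]
    rfl
  rw [h1, Q_spec hf, Polynomial.eval_finsetSum, Finset.mul_sum]
  refine Finset.sum_congr rfl fun m hm => ?_
  have hle : 0 ≤ (∑ i, b i * m i) + M := by
    have h2 : |∑ i, b i * m i| ≤ M :=
      Finset.single_le_sum (f := fun m : Fin n → ℤ => |∑ i, b i * m i|)
        (fun _ _ => abs_nonneg _) hm
    linarith [neg_abs_le (∑ i, b i * m i)]
  rw [Polynomial.eval_mul, Polynomial.eval_C, Polynomial.eval_pow, Polynomial.eval_X,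
    ← zpow_natCast, Int.toNat_of_nonneg hle, mul_left_comm, ← zpow_add₀ hexp]
  rw [neg_add_eq_sub, add_sub_cancel_right, ← prod_zpow_eq_zpow_sum _ hexp]
  refine congrArg (c m * ·) (Finset.prod_congr rfl fun i _ => ?_)
  rw [Units.val_mk0, Complex.exp_int_mul, _root_.zpow_mul]

/-! ### The Ronkin function off the amoeba -/

/-- `f` has no zero on `U(n) exp(h diag b) U(n) exp(diag y) U(n)`. -/
def NonvanishingAt {n : ℕ} (f : GL (Fin n) ℂ → ℂ) (b : Fin n → ℤ)
    (y : EuclideanSpace ℝ (Fin n)) (h : ℝ) : Prop :=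
  ∀ U W V, orbitLine f b y U W V h ≠ 0

theorem NonvanishingAt.ne_zero {n : ℕ} {f : GL (Fin n) ℂ → ℂ} {b : Fin n → ℤ}
    {y : EuclideanSpace ℝ (Fin n)} {h : ℝ} (H : NonvanishingAt f b y h) (U W V) (θ : ℝ) :
    orbitLine f b y U W V (h + θ * Complex.I) ≠ 0 := by
  rw [orbitLine_add_mul_I]
  exact H _ _ _

theorem NonvanishingAt.notMem_amoeba {n : ℕ} {f : GL (Fin n) ℂ → ℂ} {b : Fin n → ℤ}
    {y : EuclideanSpace ℝ (Fin n)} {h : ℝ} (H : NonvanishingAt f b y h) :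
    y + h • toReal b ∉ amoeba f := by
  rw [notMem_amoeba_iff]
  rintro ⟨U, V⟩
  rw [← orbitLine_one]
  exact H _ _ _

theorem eventually_nonvanishingAt {n : ℕ} {f : GL (Fin n) ℂ → ℂ} (hf : IsRegularFunction f)
    (b : Fin n → ℤ) {x : EuclideanSpace ℝ (Fin n)} (hx : x ∉ amoeba f) :
    ∀ᶠ t : EuclideanSpace ℝ (Fin n) × ℝ in 𝓝 (x, 0), NonvanishingAt f b t.1 t.2 := by
  rw [notMem_amoeba_iff] at hx
  have h := (isCompact_univ (X := Matrix.unitaryGroup (Fin n) ℂ × Matrix.unitaryGroup (Fin n) ℂ ×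
    Matrix.unitaryGroup (Fin n) ℂ)).eventually_forall_of_forall_eventually
    (x₀ := ((x, 0) : EuclideanSpace ℝ (Fin n) × ℝ))
    (P := fun t p => orbitLine f b t.1 p.1 p.2.1 p.2.2 t.2 ≠ 0) (fun p _ => by
      have hc : Continuous fun z : (EuclideanSpace ℝ (Fin n) × ℝ) ×
          (Matrix.unitaryGroup (Fin n) ℂ × Matrix.unitaryGroup (Fin n) ℂ ×
            Matrix.unitaryGroup (Fin n) ℂ) =>
          orbitLine f b z.1.1 z.2.1 z.2.2.1 z.2.2.2 z.1.2 :=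
        continuous_orbitLine hf b (by fun_prop) (by fun_prop) (by fun_prop) (by fun_prop)
          (by fun_prop)
      refine hc.continuousAt.eventually_ne ?_
      simpa [orbitLine_zero] using hx _)
  exact h.mono fun t ht U W V => ht (U, W, V) (Set.mem_univ _)

theorem isOpen_compl_amoeba {n : ℕ} {f : GL (Fin n) ℂ → ℂ} (hf : IsRegularFunction f) :
    IsOpen (amoeba f)ᶜ := by
  rw [isOpen_iff_mem_nhds]
  intro x hx
  have h := eventually_nonvanishingAt hf 0 hx
  have hc : Continuous fun y : EuclideanSpace ℝ (Fin n) => (y, (0 : ℝ)) := by fun_prop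
  filter_upwards [hc.continuousAt.eventually h] with y hy
  simpa using hy.notMem_amoeba

/-- The Ronkin integral as a real number; off the amoeba it is the value of the Ronkin function
(`ronkin_eq`). -/
noncomputable def ronkinReal {n : ℕ} (f : GL (Fin n) ℂ → ℂ) (x : EuclideanSpace ℝ (Fin n)) : ℝ :=
  ∫ p, Real.log ‖orbitValue f x p‖ ∂haarUU n

theorem continuous_orbitValue {n : ℕ} {f : GL (Fin n) ℂ → ℂ} (hf : IsRegularFunction f)
    (x : EuclideanSpace ℝ (Fin n)) : Continuous (orbitValue f x) := by
  have : Continuous fun p : Matrix.unitaryGroup (Fin n) ℂ × Matrix.unitaryGroup (Fin n) ℂ =>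
      orbitLine f 0 x p.1 1 p.2 0 :=
    continuous_orbitLine hf 0 (by fun_prop) (by fun_prop) (by fun_prop) (by fun_prop) (by fun_prop)
  simpa [orbitLine_zero] using this

theorem ronkin_eq {n : ℕ} {f : GL (Fin n) ℂ → ℂ} (hf : IsRegularFunction f)
    {x : EuclideanSpace ℝ (Fin n)} (hx : x ∉ amoeba f) : ronkin f x = (ronkinReal f x : EReal) := by
  rw [notMem_amoeba_iff] at hx
  rw [ronkin, if_pos]
  · rfl
  · exact ⟨Filter.Eventually.of_forall hx, integrable_of_continuous
      ((continuous_orbitValue hf x).norm.log fun p => norm_ne_zero_iff.2 (hx p))⟩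

theorem continuous_logMean_orbitLine {n : ℕ} {f : GL (Fin n) ℂ → ℂ} (hf : IsRegularFunction f)
    {b : Fin n → ℤ} {y : EuclideanSpace ℝ (Fin n)} {h : ℝ} (H : NonvanishingAt f b y h)
    {X : Type*} [TopologicalSpace X] {U W V : X → Matrix.unitaryGroup (Fin n) ℂ}
    (hU : Continuous U) (hW : Continuous W) (hV : Continuous V) :
    Continuous fun x => logMean (orbitLine f b y (U x) (W x) (V x)) h := by
  unfold logMean
  refine continuous_const.mul ?_
  refine intervalIntegral.continuous_parametric_intervalIntegral_of_continuous' ?_ _ _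
  refine Continuous.log ?_ fun p => norm_ne_zero_iff.2 (H.ne_zero _ _ _ _)
  exact (continuous_orbitLine hf b continuous_const (hU.comp continuous_fst)
    (hW.comp continuous_fst) (hV.comp continuous_fst) (by fun_prop)).norm

/-- By invariance of Haar measure, the Ronkin integral is the average of circle means. -/
theorem ronkinReal_eq_integral_logMean {n : ℕ} {f : GL (Fin n) ℂ → ℂ} (hf : IsRegularFunction f)
    {b : Fin n → ℤ} {y : EuclideanSpace ℝ (Fin n)} {h : ℝ} (H : NonvanishingAt f b y h) :
    ronkinReal f (y + h • toReal b) =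
      ∫ p, logMean (orbitLine f b y p.1 1 p.2) h ∂haarUU n := by
  have hθ : ∀ θ : ℝ, ∫ p, Real.log ‖orbitLine f b y p.1 1 p.2 (h + θ * Complex.I)‖ ∂haarUU n =
      ronkinReal f (y + h • toReal b) := by
    intro θ
    simp only [orbitLine_add_mul_I]
    rw [integral_mul_right_fst (phaseU fun i => b i * θ)
      fun p => Real.log ‖orbitLine f b y p.1 1 p.2 h‖]
    simp only [orbitLine_one]
    rfl
  have hcont : Continuous (Function.uncurry fun (θ : ℝ)
      (p : Matrix.unitaryGroup (Fin n) ℂ × Matrix.unitaryGroup (Fin n) ℂ) =>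
      Real.log ‖orbitLine f b y p.1 1 p.2 (h + θ * Complex.I)‖) := by
    refine Continuous.log ?_ fun p => norm_ne_zero_iff.2 (H.ne_zero _ _ _ _)
    exact (continuous_orbitLine hf b continuous_const (by fun_prop) continuous_const (by fun_prop)
      (by fun_prop)).norm
  have hint : Integrable (Function.uncurry fun (θ : ℝ)
      (p : Matrix.unitaryGroup (Fin n) ℂ × Matrix.unitaryGroup (Fin n) ℂ) =>
      Real.log ‖orbitLine f b y p.1 1 p.2 (h + θ * Complex.I)‖)
      ((volume.restrict (Set.uIoc 0 (2 * Real.pi))).prod (haarUU n)) := by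
    have h1 : (volume.restrict (Set.uIoc 0 (2 * Real.pi))).prod (haarUU n) =
        ((volume : Measure ℝ).prod (haarUU n)).restrict
          (Set.uIoc 0 (2 * Real.pi) ×ˢ Set.univ) := by
      rw [← Measure.prod_restrict, Measure.restrict_univ]
    rw [h1]
    have h2 : IsCompact (Set.uIcc 0 (2 * Real.pi) ×ˢ
        (Set.univ : Set (Matrix.unitaryGroup (Fin n) ℂ × Matrix.unitaryGroup (Fin n) ℂ))) :=
      isCompact_uIcc.prod isCompact_univ
    exact (hcont.continuousOn.integrableOn_compact h2).mono_set
      (Set.prod_mono Set.uIoc_subset_uIcc subset_rfl)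
  unfold logMean
  rw [integral_const_mul, ← intervalIntegral_integral_swap hint]
  simp only [hθ, intervalIntegral.integral_const, sub_zero, smul_eq_mul]
  rw [← mul_assoc, inv_mul_cancel₀ (by positivity), one_mul]

/-! ### Slopes of the Ronkin function along coordinate directions -/

/-- The slopes of the circle means along an integral direction are integers. -/
theorem exists_int_slope_orbitLine {n : ℕ} {f : GL (Fin n) ℂ → ℂ} (hf : IsRegularFunction f)
    {b : Fin n → ℤ} {y : EuclideanSpace ℝ (Fin n)} {δ : ℝ} (hδ : 0 < δ)
    (H : ∀ h : ℝ, |h| < δ → NonvanishingAt f b y h) (U W V : Matrix.unitaryGroup (Fin n) ℂ) :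
    ∃ N : ℤ, ∀ h : ℝ, |h| < δ →
      logMean (orbitLine f b y U W V) h = logMean (orbitLine f b y U W V) 0 + h * N := by
  obtain ⟨d, P, hP⟩ := exists_polynomial_orbitLine hf b y U W V
  obtain ⟨N, hN, -⟩ := exists_logMean_slope P d hP hδ fun h hh θ => (H h hh).ne_zero U W V θ
  exact ⟨d + N, hN⟩

theorem ronkinReal_sub_eq_integral {n : ℕ} {f : GL (Fin n) ℂ → ℂ} (hf : IsRegularFunction f)
    {b : Fin n → ℤ} {y : EuclideanSpace ℝ (Fin n)} {h : ℝ} (H0 : NonvanishingAt f b y 0)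
    (H : NonvanishingAt f b y h) :
    ronkinReal f (y + h • toReal b) - ronkinReal f y =
      ∫ p, (logMean (orbitLine f b y p.1 1 p.2) h - logMean (orbitLine f b y p.1 1 p.2) 0)
        ∂haarUU n := by
  rw [integral_sub (integrable_of_continuous
      (continuous_logMean_orbitLine hf H continuous_fst continuous_const continuous_snd))
    (integrable_of_continuous
      (continuous_logMean_orbitLine hf H0 continuous_fst continuous_const continuous_snd)),
    ← ronkinReal_eq_integral_logMean hf H, ← ronkinReal_eq_integral_logMean hf H0]
  simp

theorem exists_ronkinReal_affine {n : ℕ} {f : GL (Fin n) ℂ → ℂ} (hf : IsRegularFunction f)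
    {b : Fin n → ℤ} {y : EuclideanSpace ℝ (Fin n)} {δ : ℝ} (hδ : 0 < δ)
    (H : ∀ h : ℝ, |h| < δ → NonvanishingAt f b y h) :
    ∃ c : ℝ, ∀ h : ℝ, |h| < δ → ronkinReal f (y + h • toReal b) = ronkinReal f y + h * c := by
  have H0 := H 0 (by simpa using hδ)
  have hδ2 : |δ / 2| < δ := by rw [abs_of_pos (by positivity)]; linarith
  refine ⟨(ronkinReal f (y + (δ / 2) • toReal b) - ronkinReal f y) / (δ / 2), fun h hh => ?_⟩
  have key : ronkinReal f (y + h • toReal b) - ronkinReal f y =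
      h / (δ / 2) * (ronkinReal f (y + (δ / 2) • toReal b) - ronkinReal f y) := by
    rw [ronkinReal_sub_eq_integral hf H0 (H h hh), ronkinReal_sub_eq_integral hf H0 (H _ hδ2),
      ← integral_const_mul]
    refine integral_congr_ae (Filter.Eventually.of_forall fun p => ?_)
    obtain ⟨N, hN⟩ := exists_int_slope_orbitLine hf hδ H p.1 1 p.2
    simp only
    rw [hN h hh, hN _ hδ2]
    field_simp
    ring
  rw [← sub_eq_iff_eq_add', key]
  ring

theorem star_swap_permMatrix {n : ℕ} (i j : Fin n) :
    star ((Equiv.swap i j).permMatrix ℂ) = (Equiv.swap i j).permMatrix ℂ := by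
  rw [Matrix.star_eq_conjTranspose, Matrix.conjTranspose_permMatrix, Equiv.swap_inv]

theorem swap_permMatrix_mul_self {n : ℕ} (i j : Fin n) :
    (Equiv.swap i j).permMatrix ℂ * (Equiv.swap i j).permMatrix ℂ = 1 := by
  rw [← Matrix.permMatrix_mul, Equiv.swap_mul_self, Matrix.permMatrix_one]

/-- The path `(1 + T) / 2 + exp(is) (1 - T) / 2` of unitary matrices, which joins `1` to the
transposition matrix `T` at `s = π`. -/
noncomputable def swapPath {n : ℕ} (i j : Fin n) (s : ℝ) : Matrix.unitaryGroup (Fin n) ℂ :=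
  ⟨((1 + Complex.exp (s * Complex.I)) / 2) • (1 : Matrix (Fin n) (Fin n) ℂ) +
    ((1 - Complex.exp (s * Complex.I)) / 2) • (Equiv.swap i j).permMatrix ℂ, by
    rw [Matrix.mem_unitaryGroup_iff]
    set a := Complex.exp (s * Complex.I) with ha
    have haa : a * star a = 1 := by
      rw [ha]
      simp [← Complex.exp_conj, ← Complex.exp_add]
    rw [star_add, star_smul, star_smul, star_one, star_swap_permMatrix, add_mul, mul_add, mul_add]
    simp only [smul_mul_smul_comm, one_mul, mul_one, swap_permMatrix_mul_self]
    have e : ∀ (p q r t : ℂ) (M N : Matrix (Fin n) (Fin n) ℂ),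
        p • M + q • N + (r • N + t • M) = (p + t) • M + (q + r) • N := by
      intros; module
    rw [e]
    have h1 : (1 + a) / 2 * star ((1 + a) / 2) + (1 - a) / 2 * star ((1 - a) / 2) = 1 := by
      simp only [star_div₀, star_add, star_sub, star_one, star_ofNat]
      linear_combination (1 / 2 : ℂ) * haa
    have h2 : (1 + a) / 2 * star ((1 - a) / 2) + (1 - a) / 2 * star ((1 + a) / 2) = 0 := by
      simp only [star_div₀, star_add, star_sub, star_one, star_ofNat]
      linear_combination (-1 / 2 : ℂ) * haa
    rw [h1, h2, one_smul, zero_smul, add_zero]⟩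

theorem continuous_swapPath {n : ℕ} (i j : Fin n) : Continuous (swapPath i j) := by
  refine Continuous.subtype_mk ?_ _
  fun_prop

theorem swapPath_zero {n : ℕ} (i j : Fin n) : swapPath i j 0 = 1 := by
  apply Subtype.ext
  simp [swapPath]

theorem swapPath_pi {n : ℕ} (i j : Fin n) : swapPath i j Real.pi = permU (Equiv.swap i j) := by
  apply Subtype.ext
  simp [swapPath, permU]

/-- A continuous function with values in `ℤ h` is constant. -/
theorem eq_of_continuous_of_int_mul {D : ℝ → ℝ} (hD : Continuous D) (h : ℝ)
    (hint : ∀ s, ∃ N : ℤ, D s = h * N) (s t : ℝ) : D s = D t := by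
  rcases eq_or_ne h 0 with rfl | hh
  · obtain ⟨N, hN⟩ := hint s
    obtain ⟨M, hM⟩ := hint t
    rw [hN, hM, zero_mul, zero_mul]
  have hdisc : DiscreteTopology (Set.range ((↑) : ℤ → ℝ)) :=
    Int.isClosedEmbedding_coe_real.isEmbedding.toHomeomorph.symm.isEmbedding.discreteTopology
  have := isPreconnected_univ.constant_of_mapsTo (T := Set.range ((↑) : ℤ → ℝ))
    (f := fun s => D s / h) ⟨hdisc⟩ (hD.div_const h).continuousOn (fun s _ => by
      obtain ⟨N, hN⟩ := hint s
      exact ⟨N, by simp only [hN]; field_simp⟩) (Set.mem_univ s) (Set.mem_univ t)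
  simpa [div_left_inj' hh] using this

theorem orbitLine_single_swap {n : ℕ} (f : GL (Fin n) ℂ → ℂ) (i j : Fin n)
    (y : EuclideanSpace ℝ (Fin n)) (U V : Matrix.unitaryGroup (Fin n) ℂ) :
    orbitLine f (Pi.single i 1) y U 1 V = orbitLine f (Pi.single j 1) y
      (U * permU (Equiv.swap i j)) (permU (Equiv.swap i j)) V := by
  funext ζ
  unfold orbitLine
  set T := Unitary.toUnits (permU (Equiv.swap i j)) with hT
  have hTT : T * T = 1 := by
    apply Units.ext
    exact swap_permMatrix_mul_self i j
  have h := permU_mul_diagGL (Equiv.swap i j) fun l =>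
    Units.mk0 (Complex.exp ((Pi.single j (1 : ℤ) : Fin n → ℤ) l * ζ)) (Complex.exp_ne_zero _)
  have h2 : T * expGL (fun l => ((Pi.single j (1 : ℤ) : Fin n → ℤ) l : ℂ) * ζ) =
      expGL (fun l => ((Pi.single i (1 : ℤ) : Fin n → ℤ) l : ℂ) * ζ) * T := by
    refine h.trans ?_
    congr 1
    refine congrArg diagGL (funext fun l => Units.ext ?_)
    simp only [Function.comp_apply, Units.val_mk0]
    have : (Pi.single j (1 : ℤ) : Fin n → ℤ) (Equiv.swap i j l) =
        (Pi.single i (1 : ℤ) : Fin n → ℤ) l := by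
      simp only [Pi.single_apply]
      congr 1
      rw [Equiv.swap_apply_eq_iff, Equiv.swap_apply_right]
    rw [this]
  congr 3
  rw [map_one, mul_one, map_mul, ← hT, mul_assoc _ T, h2, mul_assoc, mul_assoc _ T, hTT, mul_one]

/-- The slopes of the Ronkin function in two coordinate directions agree: a transposition matrix,
joined to `1` inside `U(n)`, deforms one coordinate circle into the other, and the integer slopes
cannot jump along the deformation. -/
theorem ronkinReal_single_eq {n : ℕ} {f : GL (Fin n) ℂ → ℂ} (hf : IsRegularFunction f)
    {y : EuclideanSpace ℝ (Fin n)} {δ : ℝ} (hδ : 0 < δ) {i j : Fin n}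
    (Hi : ∀ h : ℝ, |h| < δ → NonvanishingAt f (Pi.single i 1) y h)
    (Hj : ∀ h : ℝ, |h| < δ → NonvanishingAt f (Pi.single j 1) y h) {h : ℝ} (hh : |h| < δ) :
    ronkinReal f (y + h • toReal (Pi.single i 1)) =
      ronkinReal f (y + h • toReal (Pi.single j 1)) := by
  have h0 : |(0 : ℝ)| < δ := by simpa using hδ
  suffices ronkinReal f (y + h • toReal (Pi.single i 1)) - ronkinReal f y =
      ronkinReal f (y + h • toReal (Pi.single j 1)) - ronkinReal f y by linarith
  rw [ronkinReal_sub_eq_integral hf (Hi 0 h0) (Hi h hh),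
    ronkinReal_sub_eq_integral hf (Hj 0 h0) (Hj h hh)]
  refine Eq.trans ?_ (integral_mul_right_fst (permU (Equiv.swap i j)) fun p =>
    logMean (orbitLine f (Pi.single j 1) y p.1 1 p.2) h -
      logMean (orbitLine f (Pi.single j 1) y p.1 1 p.2) 0)
  refine integral_congr_ae (Filter.Eventually.of_forall fun p => ?_)
  simp only [orbitLine_single_swap f i j]
  have := eq_of_continuous_of_int_mul (D := fun s =>
      logMean (orbitLine f (Pi.single j 1) y (p.1 * permU (Equiv.swap i j))
        (swapPath i j s) p.2) h -
      logMean (orbitLine f (Pi.single j 1) y (p.1 * permU (Equiv.swap i j))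
        (swapPath i j s) p.2) 0)
    ((continuous_logMean_orbitLine hf (Hj h hh) continuous_const (continuous_swapPath i j)
      continuous_const).sub (continuous_logMean_orbitLine hf (Hj 0 h0) continuous_const
        (continuous_swapPath i j) continuous_const)) h (fun s => by
      obtain ⟨N, hN⟩ := exists_int_slope_orbitLine hf hδ Hj (p.1 * permU (Equiv.swap i j))
        (swapPath i j s) p.2
      exact ⟨N, by rw [hN h hh]; ring⟩) Real.pi 0
  simpa only [swapPath_pi, swapPath_zero] using this

/-- Off the amoeba the Ronkin function is locally an affine function of the coordinate sum. -/
theorem exists_ronkinReal_local_affine {n : ℕ} [NeZero n] {f : GL (Fin n) ℂ → ℂ}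
    (hf : IsRegularFunction f) {x : EuclideanSpace ℝ (Fin n)} (hx : x ∉ amoeba f) :
    ∃ s : ℝ, ∃ δ > 0, ∀ y ∈ Metric.ball x δ,
      y ∉ amoeba f ∧ ronkinReal f y = ronkinReal f x + s * ∑ i, (y i - x i) := by
  have hev : ∀ᶠ t : EuclideanSpace ℝ (Fin n) × ℝ in 𝓝 (x, 0),
      t.1 ∉ amoeba f ∧ ∀ i, NonvanishingAt f (Pi.single i 1) t.1 t.2 := by
    refine Filter.Eventually.and ?_
      (Filter.eventually_all.2 fun i => eventually_nonvanishingAt hf _ hx)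
    exact continuous_fst.continuousAt.eventually (p := fun y => y ∉ amoeba f)
      ((isOpen_compl_amoeba hf).mem_nhds hx)
  obtain ⟨δ, hδ, hball⟩ := Metric.eventually_nhds_iff_ball.1 hev
  have hin : ∀ y ∈ Metric.ball x δ, ∀ h : ℝ, |h| < δ →
      y ∉ amoeba f ∧ ∀ i, NonvanishingAt f (Pi.single i 1) y h := by
    intro y hy h hh
    refine hball (y, h) ?_
    rw [← ball_prod_same]
    exact ⟨hy, by simpa using hh⟩
  have hslope : ∀ y ∈ Metric.ball x δ, ∃ s : ℝ, ∀ i, ∀ h : ℝ, |h| < δ →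
      ronkinReal f (y + h • toReal (Pi.single i 1)) = ronkinReal f y + h * s := by
    intro y hy
    obtain ⟨s, hs⟩ := exists_ronkinReal_affine hf hδ fun h hh => (hin y hy h hh).2 0
    refine ⟨s, fun i h hh => ?_⟩
    rw [← hs h hh]
    exact ronkinReal_single_eq hf hδ (fun h hh => (hin y hy h hh).2 i)
      (fun h hh => (hin y hy h hh).2 0) hh
  choose! s hs using hslope
  -- the common slope is invariant under moves along coordinate directions
  have hmove : ∀ y ∈ Metric.ball x δ, ∀ i, ∀ t : ℝ, |t| < δ →
      y + t • toReal (Pi.single i 1) ∈ Metric.ball x δ →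
      s (y + t • toReal (Pi.single i 1)) = s y := by
    intro y hy i t ht hyt
    obtain ⟨ht1, ht2⟩ := abs_lt.1 ht
    set u := (δ - t) / 2 with hu
    have hupos : 0 < u := by rw [hu]; linarith
    have h1 := hs _ hyt i u (by rw [abs_of_pos hupos]; linarith)
    have h2 := hs y hy i t ht
    have h3 := hs y hy i (t + u) (by rw [abs_lt]; constructor <;> linarith)
    rw [add_smul, ← add_assoc, h1, h2] at h3
    have : u * s (y + t • toReal (Pi.single i 1)) = u * s y := by linarith
    exact mul_left_cancel₀ hupos.ne' this
  refine ⟨s x, δ, hδ, fun y hy => ⟨(hin y hy 0 (by simpa using hδ)).1, ?_⟩⟩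
  set w := y - x with hw
  have hwn : ‖w‖ < δ := by simpa [dist_eq_norm] using hy
  let r : Finset (Fin n) → EuclideanSpace ℝ (Fin n) := fun S =>
    ∑ i ∈ S, w i • toReal (Pi.single i 1)
  have hrval : ∀ S i, r S i = if i ∈ S then w i else 0 := by
    intro S i
    simp [r, toReal, Pi.single_apply]
  have hrn : ∀ S, ‖r S‖ < δ := by
    intro S
    refine lt_of_le_of_lt ?_ hwn
    rw [EuclideanSpace.norm_eq, EuclideanSpace.norm_eq]
    refine Real.sqrt_le_sqrt (Finset.sum_le_sum fun i _ => ?_)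
    rw [hrval]
    split_ifs
    · exact le_rfl
    · simpa using sq_nonneg (w i)
  have hrb : ∀ S, x + r S ∈ Metric.ball x δ := fun S => by simpa [dist_eq_norm] using hrn S
  have hwi : ∀ i, |w i| < δ := fun i => by
    refine lt_of_le_of_lt ?_ hwn
    simpa using PiLp.norm_apply_le w i
  have hind : ∀ S, ronkinReal f (x + r S) = ronkinReal f x + s x * ∑ i ∈ S, w i ∧
      s (x + r S) = s x := by
    intro S
    induction S using Finset.induction_on with
    | empty => simp [r]
    | insert i S hi ih =>
      have e : x + r (insert i S) = x + r S + w i • toReal (Pi.single i 1) := by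
        simp only [r, Finset.sum_insert hi]
        abel
      have hb := hrb (insert i S)
      rw [e] at hb ⊢
      refine ⟨?_, ?_⟩
      · rw [hs _ (hrb S) i _ (hwi i), ih.1, ih.2, Finset.sum_insert hi]
        ring
      · rw [hmove _ (hrb S) i _ (hwi i) hb, ih.2]
  have hfull : x + r Finset.univ = y := by
    ext i
    simp [hrval, hw]
  have := (hind Finset.univ).1
  rw [hfull] at this
  simpa [hw] using this

/-! ### The order of a complement component -/

theorem HasRonkinGradientAt.unique {n : ℕ} {f : GL (Fin n) ℂ → ℂ}
    {v w x : EuclideanSpace ℝ (Fin n)} (hv : HasRonkinGradientAt f v x)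
    (hw : HasRonkinGradientAt f w x) : v = w := by
  obtain ⟨R, hR, hRv⟩ := hv
  obtain ⟨S, hS, hSw⟩ := hw
  refine hRv.unique (hSw.congr_of_eventuallyEq ?_)
  filter_upwards [hR, hS] with y h1 h2
  exact EReal.coe_injective (h1.symm.trans h2)

theorem hasRonkinGradientAt_of_affine {n : ℕ} {f : GL (Fin n) ℂ → ℂ}
    (hf : IsRegularFunction f) {x z : EuclideanSpace ℝ (Fin n)} {s c : ℝ}
    (h : ∀ᶠ y in 𝓝 x, y ∉ amoeba f ∧ ronkinReal f y = c + s * ∑ i, (y i - z i)) :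
    HasRonkinGradientAt f (s • ones n) x := by
  refine ⟨ronkinReal f, h.mono fun y hy => ronkin_eq hf hy.1, ?_⟩
  have haff : HasGradientAt (fun y => c + inner ℝ (s • ones n) (y - z)) (s • ones n) x := by
    rw [hasGradientAt_iff_hasFDerivAt]
    exact (((InnerProductSpace.toDual ℝ _ (s • ones n)).hasFDerivAt).comp x
      ((hasFDerivAt_id x).sub_const z)).const_add c
  refine haff.congr_of_eventuallyEq (h.mono fun y hy => ?_)
  simp only
  rw [hy.2, real_inner_smul_left, inner_ones]
  rfl

/-- Off the amoeba the Ronkin function has a gradient, a real multiple of `𝟏`, and the gradient is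
locally constant. -/
theorem exists_slope {n : ℕ} [NeZero n] {f : GL (Fin n) ℂ → ℂ} (hf : IsRegularFunction f)
    {x : EuclideanSpace ℝ (Fin n)} (hx : x ∉ amoeba f) :
    ∃ s : ℝ, (∀ᶠ y in 𝓝 x, HasRonkinGradientAt f (s • ones n) y) ∧
      ∀ᶠ y in 𝓝 x, ronkinReal f y = ronkinReal f x + s * ∑ i, (y i - x i) := by
  obtain ⟨s, δ, hδ, h⟩ := exists_ronkinReal_local_affine hf hx
  have hball := Metric.ball_mem_nhds x hδ
  refine ⟨s, ?_, Filter.mem_of_superset hball fun y hy => (h y hy).2⟩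
  refine Filter.mem_of_superset hball fun y hy => ?_
  exact hasRonkinGradientAt_of_affine hf
    (Filter.mem_of_superset (Metric.isOpen_ball.mem_nhds hy) h)

/-- The order of a component is the gradient at each of its points, because the gradient is locally
constant and the component is connected. -/
theorem hasRonkinGradientAt_of_isOrder {n : ℕ} [NeZero n] {f : GL (Fin n) ℂ → ℂ}
    (hf : IsRegularFunction f) {E : Set (EuclideanSpace ℝ (Fin n))}
    (hE : E ∈ complementComponents f) {v : EuclideanSpace ℝ (Fin n)} (hv : IsOrder f E v) :
    ∀ x ∈ E, HasRonkinGradientAt f v x := by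
  obtain ⟨x₀, hx₀, rfl⟩ := hE
  obtain ⟨x, hx, hxv⟩ := hv
  set E := connectedComponentIn (amoeba f)ᶜ x₀
  have hsub : E ⊆ (amoeba f)ᶜ := connectedComponentIn_subset _ _
  set A : Set (EuclideanSpace ℝ (Fin n)) :=
    interior {y | HasRonkinGradientAt f v y}
  set B : Set (EuclideanSpace ℝ (Fin n)) :=
    interior {y | ∃ w, w ≠ v ∧ HasRonkinGradientAt f w y}
  have hcover : E ⊆ A ∪ B := by
    intro y hy
    obtain ⟨s, hs, -⟩ := exists_slope hf (hsub hy)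
    by_cases hsv : s • ones n = v
    · left
      rw [mem_interior_iff_mem_nhds]
      rw [hsv] at hs
      exact hs
    · right
      rw [mem_interior_iff_mem_nhds]
      filter_upwards [hs] with z hz
      exact ⟨_, hsv, hz⟩
  have hdisj : Disjoint A B := by
    rw [Set.disjoint_left]
    intro y hA hB
    obtain ⟨w, hw, hwy⟩ := interior_subset (s := {y | ∃ w, w ≠ v ∧ HasRonkinGradientAt f w y}) hB
    exact hw (hwy.unique (interior_subset (s := {y | HasRonkinGradientAt f v y}) hA))
  have hmem : x ∈ A := by
    rcases hcover hx with h | h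
    · exact h
    · obtain ⟨w, hw, hwy⟩ := interior_subset (s := {y | ∃ w, w ≠ v ∧ HasRonkinGradientAt f w y}) h
      exact absurd (hwy.unique hxv) hw
  intro y hy
  have := isPreconnected_connectedComponentIn.subset_left_of_subset_union isOpen_interior
    isOpen_interior hdisj hcover ⟨x, hx, hmem⟩ hy
  exact interior_subset (s := {y | HasRonkinGradientAt f v y}) this

/-- Every order is a real multiple of `𝟏`. -/
theorem exists_eq_smul_ones_of_isOrder {n : ℕ} [NeZero n] {f : GL (Fin n) ℂ → ℂ}
    (hf : IsRegularFunction f) {E : Set (EuclideanSpace ℝ (Fin n))}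
    (hE : E ∈ complementComponents f) {v : EuclideanSpace ℝ (Fin n)} (hv : IsOrder f E v) :
    ∃ s : ℝ, v = s • ones n := by
  obtain ⟨x₀, hx₀, rfl⟩ := hE
  obtain ⟨x, hx, hxv⟩ := hv
  obtain ⟨s, hs, -⟩ := exists_slope hf (connectedComponentIn_subset _ _ hx)
  exact ⟨s, hxv.unique hs.self_of_nhds⟩

/-! ### Components whose order is a symmetric vertex -/

theorem orbitLine_const_eq {n : ℕ} (f : GL (Fin n) ℂ → ℂ) (ε : ℤ) (y : EuclideanSpace ℝ (Fin n))
    (U V : Matrix.unitaryGroup (Fin n) ℂ) (ζ : ℂ) :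
    orbitLine f (fun _ => ε) y U 1 V ζ =
      f (scalarGL n (Units.mk0 (Complex.exp ζ) (Complex.exp_ne_zero ζ) ^ ε) *
        (Unitary.toUnits U * expDiag y * Unitary.toUnits (star V))) := by
  have h : expGL (fun _ : Fin n => (ε : ℂ) * ζ) =
      scalarGL n (Units.mk0 (Complex.exp ζ) (Complex.exp_ne_zero ζ) ^ ε) := by
    refine congrArg diagGL (funext fun _ => Units.ext ?_)
    rw [Units.val_mk0, Units.val_zpow_eq_zpow_val, Units.val_mk0, Complex.exp_int_mul]
  unfold orbitLine
  rw [h, map_one, mul_one, ← scalarGL_mul_comm]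
  simp only [mul_assoc]

/-- A continuous nonnegative function on `U(n) × U(n)` with integral zero vanishes everywhere. -/
theorem eq_zero_of_integral_eq_zero {n : ℕ}
    {F : Matrix.unitaryGroup (Fin n) ℂ × Matrix.unitaryGroup (Fin n) ℂ → ℝ} (hF : Continuous F)
    (h0 : ∀ p, 0 ≤ F p) (hint : ∫ p, F p ∂haarUU n = 0) (p) : F p = 0 := by
  have h := (integral_eq_zero_iff_of_nonneg h0 (integrable_of_continuous hF)).1 hint
  have := (Continuous.ae_eq_iff_eq (haarUU n) hF continuous_zero).1 h
  exact congrFun this p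

/-- Suppose `k𝟏` is the strict extremum of the coordinate sum on the support, in the direction
given by the sign `ε`. By Jensen's formula the slope of the Ronkin function along `ε𝟏` exceeds
`ε n k` by the average number of zeros of `τ ↦ f (τ ^ ε U exp(diag y) V^*)` in the punctured unit
disc, so that the gradient is `k𝟏` exactly when there are no such zeros. -/
theorem slope_eq_iff {n : ℕ} [NeZero n] {f : GL (Fin n) ℂ → ℂ} (hf : IsRegularFunction f)
    {k ε : ℤ} (hε : ε = 1 ∨ ε = -1) (hk : (fun _ => k) ∈ support f)
    (hmin : ∀ m ∈ support f, m ≠ (fun _ => k) → ε * (n * k) < ε * ∑ i, m i)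
    {y : EuclideanSpace ℝ (Fin n)} (hy : y ∉ amoeba f) {s : ℝ}
    (hs : HasRonkinGradientAt f (s • ones n) y) :
    s = k ↔ ∀ h : ℝ, h < 0 → y + h • toReal (fun _ => ε) ∉ amoeba f := by
  obtain ⟨J, a, c, -, hexp, hlead⟩ := exists_extreme_expansion hf hε hk hmin
  have hn : (n : ℝ) ≠ 0 := by exact_mod_cast NeZero.ne n
  have hε0 : (ε : ℝ) ≠ 0 := by rcases hε with rfl | rfl <;> norm_num
  set b : Fin n → ℤ := fun _ => ε with hb
  set d : ℤ := ε * (n * k) with hd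
  -- the polynomial in `τ` attached to a pair of unitary matrices
  let P : Matrix.unitaryGroup (Fin n) ℂ × Matrix.unitaryGroup (Fin n) ℂ → Polynomial ℂ := fun p =>
    ∑ j ∈ Finset.range J, Polynomial.C
      (c j (Unitary.toUnits p.1 * expDiag y * Unitary.toUnits (star p.2))) * Polynomial.X ^ a j
  have hPev : ∀ p τ, (P p).eval τ = ∑ j ∈ Finset.range J,
      c j (Unitary.toUnits p.1 * expDiag y * Unitary.toUnits (star p.2)) * τ ^ a j := by
    intro p τ
    simp [P, Polynomial.eval_finsetSum]
  have hP : ∀ p ζ, orbitLine f b y p.1 1 p.2 ζ =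
      Complex.exp ζ ^ d * (P p).eval (Complex.exp ζ) := by
    intro p ζ
    rw [hb, orbitLine_const_eq, hexp, hPev]
    rfl
  have hP0 : ∀ p, (P p).eval 0 ≠ 0 := by
    intro p
    rw [hPev]
    exact hlead _
  have hzeros : (∀ p, ∀ τ : ℂ, ‖τ‖ < 1 → (P p).eval τ ≠ 0) ↔
      ∀ h : ℝ, h < 0 → y + h • toReal b ∉ amoeba f := by
    constructor
    · intro H h hh
      rw [notMem_amoeba_iff]
      intro p
      rw [← orbitLine_one f b y p.1 p.2, hP]
      refine mul_ne_zero (zpow_ne_zero _ (Complex.exp_ne_zero _)) (H p _ ?_)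
      rw [Complex.norm_exp]
      simpa using hh
    · intro H p τ hτ h0
      rcases eq_or_ne τ 0 with rfl | hτ0
      · exact hP0 p h0
      have hτpos : 0 < ‖τ‖ := norm_pos_iff.2 hτ0
      have hneg := Real.log_neg hτpos hτ
      have := notMem_amoeba_iff.1 (H _ hneg) (p.1 * phaseU (fun i => b i * τ.arg), p.2)
      rw [← orbitLine_one, ← orbitLine_add_mul_I] at this
      have e : Complex.exp ((Real.log ‖τ‖ : ℝ) + τ.arg * Complex.I) = τ := by
        rw [Complex.exp_add, ← Complex.ofReal_exp, Real.exp_log hτpos,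
          Complex.norm_mul_exp_arg_mul_I]
      have hz := hP p ((Real.log ‖τ‖ : ℝ) + τ.arg * Complex.I)
      rw [e, h0, mul_zero] at hz
      exact this hz
  rw [← hzeros]
  -- a radius on which nothing vanishes and the Ronkin function is affine
  obtain ⟨s', hs', haff⟩ := exists_slope hf hy
  have hss : s' = s := by
    have h := congrArg (fun v : EuclideanSpace ℝ (Fin n) => v 0) (hs'.self_of_nhds.unique hs)
    simpa [ones] using h
  rw [hss] at haff
  have hev : ∀ᶠ h : ℝ in 𝓝 0, NonvanishingAt f b y h ∧
      ronkinReal f (y + h • toReal b) = ronkinReal f y + s * ∑ i, ((y + h • toReal b) i - y i) := by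
    refine Filter.Eventually.and ?_ ?_
    · have hc : Continuous fun h : ℝ => (y, h) := by fun_prop
      exact hc.continuousAt.eventually (eventually_nonvanishingAt hf b hy)
    · have hc : Continuous fun h : ℝ => y + h • toReal b := by fun_prop
      refine hc.continuousAt.eventually (p := fun z => ronkinReal f z = ronkinReal f y +
        s * ∑ i, (z i - y i)) ?_
      simpa using haff
  obtain ⟨δ, hδ, hball⟩ := Metric.eventually_nhds_iff.1 hev
  have hNV : ∀ h : ℝ, |h| < δ → NonvanishingAt f b y h := fun h hh =>
    (hball (by simpa using hh)).1
  have hh0 : |δ / 2| < δ := by rw [abs_of_pos (by positivity)]; linarith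
  have h00 : |(0 : ℝ)| < δ := by simpa using hδ
  choose N hN hN0 using fun p => exists_logMean_slope (P p) d (hP p) hδ
    fun h hh θ => (hNV h hh).ne_zero p.1 1 p.2 θ
  set Z : Matrix.unitaryGroup (Fin n) ℂ × Matrix.unitaryGroup (Fin n) ℂ → ℝ := fun p =>
    logMean (orbitLine f b y p.1 1 p.2) (δ / 2) - logMean (orbitLine f b y p.1 1 p.2) 0 -
      δ / 2 * d with hZ
  have hZN : ∀ p, Z p = δ / 2 * N p := by
    intro p
    simp only [hZ]
    rw [hN p _ hh0]
    push_cast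
    ring
  have hcont0 : Continuous fun p : Matrix.unitaryGroup (Fin n) ℂ × Matrix.unitaryGroup (Fin n) ℂ =>
      logMean (orbitLine f b y p.1 1 p.2) (δ / 2) - logMean (orbitLine f b y p.1 1 p.2) 0 :=
    (continuous_logMean_orbitLine hf (hNV _ hh0) continuous_fst continuous_const
      continuous_snd).sub (continuous_logMean_orbitLine hf (hNV _ h00) continuous_fst
        continuous_const continuous_snd)
  have hZc : Continuous Z := hcont0.sub continuous_const
  have hint : ∫ p, Z p ∂haarUU n = δ / 2 * (ε * n) * (s - k) := by
    have h1 := (hball (show dist (δ / 2) 0 < δ by rw [Real.dist_0_eq_abs]; exact hh0)).2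
    have h2 : ∑ i, ((y + (δ / 2) • toReal b) i - y i) = n * (δ / 2 * ε) := by
      simp [toReal, hb]
    rw [h2] at h1
    rw [hZ, integral_sub (integrable_of_continuous hcont0) (integrable_const _),
      ← ronkinReal_sub_eq_integral hf (hNV _ h00) (hNV _ hh0), h1, integral_const]
    simp [hd]
    ring
  have hall : (∀ p, ∀ τ : ℂ, ‖τ‖ < 1 → (P p).eval τ ≠ 0) ↔ ∀ p, Z p = 0 := by
    refine forall_congr' fun p => ?_
    rw [← hN0 p, hZN p]
    simp [hδ.ne']
  rw [hall]
  constructor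
  · intro hsk
    refine eq_zero_of_integral_eq_zero hZc (fun p => ?_) (by rw [hint, hsk]; ring)
    rw [hZN]
    positivity
  · intro hz
    simp only [hz, integral_zero] at hint
    have hne : δ / 2 * (ε * n) ≠ 0 := by positivity
    have := (mul_eq_zero.1 hint.symm).resolve_left hne
    linarith

/-- Far out in the direction `-ε𝟏` every translate of a compact set lies off the amoeba, since the
extreme homogeneous part of `f` vanishes nowhere. -/
theorem eventually_translate_notMem_amoeba {n : ℕ} {f : GL (Fin n) ℂ → ℂ}
    (hf : IsRegularFunction f) {k ε : ℤ} (hε : ε = 1 ∨ ε = -1) (hk : (fun _ => k) ∈ support f)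
    (hmin : ∀ m ∈ support f, m ≠ (fun _ => k) → ε * (n * k) < ε * ∑ i, m i)
    {C : Set (EuclideanSpace ℝ (Fin n))} (hC : IsCompact C) :
    ∀ᶠ h : ℝ in Filter.atBot, ∀ y ∈ C, y + h • toReal (fun _ => ε) ∉ amoeba f := by
  obtain ⟨J, a, c, hc, hexp, hlead⟩ := exists_extreme_expansion hf hε hk hmin
  have hK := ((isCompact_univ (X := Matrix.unitaryGroup (Fin n) ℂ ×
    Matrix.unitaryGroup (Fin n) ℂ)).prod hC).eventually_forall_of_forall_eventually
    (x₀ := (0 : ℂ)) (P := fun τ q => ∑ j ∈ Finset.range J,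
      orbitValue (c j) q.2 q.1 * τ ^ a j ≠ 0) (fun q _ => by
      have hcont : Continuous fun z : ℂ × ((Matrix.unitaryGroup (Fin n) ℂ ×
          Matrix.unitaryGroup (Fin n) ℂ) × EuclideanSpace ℝ (Fin n)) =>
          ∑ j ∈ Finset.range J, orbitValue (c j) z.2.2 z.2.1 * z.1 ^ a j := by
        refine continuous_finsetSum _ fun j _ => Continuous.mul ?_ (by fun_prop)
        have : Continuous fun z : ℂ × ((Matrix.unitaryGroup (Fin n) ℂ ×
            Matrix.unitaryGroup (Fin n) ℂ) × EuclideanSpace ℝ (Fin n)) =>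
            orbitLine (c j) 0 z.2.2 z.2.1.1 1 z.2.1.2 0 :=
          continuous_orbitLine (hc j) 0 (by fun_prop) (by fun_prop) (by fun_prop) (by fun_prop)
            (by fun_prop)
        simpa [orbitLine_zero] using this
      refine hcont.continuousAt.eventually_ne ?_
      exact hlead _)
  have htend : Filter.Tendsto (fun h : ℝ => Complex.exp h) Filter.atBot (𝓝 0) := by
    have := Complex.continuous_ofReal.tendsto 0 |>.comp Real.tendsto_exp_atBot
    simpa [Function.comp_def] using this
  filter_upwards [htend.eventually hK] with h hh y hy
  rw [notMem_amoeba_iff]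
  rintro ⟨U, V⟩
  rw [← orbitLine_one, orbitLine_const_eq, hexp]
  exact mul_ne_zero (zpow_ne_zero _ (Units.ne_zero _)) (hh ((U, V), y) ⟨Set.mem_univ _, hy⟩)

theorem mem_of_segment_subset {n : ℕ} {f : GL (Fin n) ℂ → ℂ}
    {E : Set (EuclideanSpace ℝ (Fin n))} (hE : E ∈ complementComponents f)
    {p q : EuclideanSpace ℝ (Fin n)} (hp : p ∈ E) (h : segment ℝ p q ⊆ (amoeba f)ᶜ) : q ∈ E := by
  obtain ⟨x, hx, rfl⟩ := hE
  rw [connectedComponentIn_eq hp]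
  exact (convex_segment p q).isPreconnected.subset_connectedComponentIn
    (left_mem_segment ℝ p q) h (right_mem_segment ℝ p q)

theorem segment_add_smul_subset {n : ℕ} {S : Set (EuclideanSpace ℝ (Fin n))}
    {y w : EuclideanSpace ℝ (Fin n)} {t u : ℝ} (hut : u ≤ t)
    (h : ∀ r ≤ t, y + r • w ∈ S) : segment ℝ (y + t • w) (y + u • w) ⊆ S := by
  rw [segment_eq_image']
  rintro _ ⟨θ, ⟨hθ0, hθ1⟩, rfl⟩
  have e : y + t • w + θ • (y + u • w - (y + t • w)) = y + (t + θ * (u - t)) • w := by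
    module
  simp only
  rw [e]
  exact h _ (by nlinarith)

theorem exists_component_of_extreme {n : ℕ} [NeZero n] {f : GL (Fin n) ℂ → ℂ}
    (hf : IsRegularFunction f) {k ε : ℤ} (hε : ε = 1 ∨ ε = -1) (hk : (fun _ => k) ∈ support f)
    (hmin : ∀ m ∈ support f, m ≠ (fun _ => k) → ε * (n * k) < ε * ∑ i, m i) :
    ∃ E ∈ complementComponents f, IsOrder f E ((k : ℝ) • ones n) := by
  obtain ⟨h₀, hh₀⟩ := Filter.eventually_atBot.1
    (eventually_translate_notMem_amoeba hf hε hk hmin (isCompact_singleton (x := 0)))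
  have hmem : ∀ h ≤ h₀, h • toReal (fun _ => ε) ∉ amoeba f := fun h hh => by
    simpa using hh₀ h hh 0 rfl
  have hx := hmem h₀ le_rfl
  obtain ⟨s, hs, -⟩ := exists_slope hf hx
  have hsk : s = k := (slope_eq_iff hf hε hk hmin hx hs.self_of_nhds).2 fun h hh => by
    rw [← add_smul]
    exact hmem _ (by linarith)
  refine ⟨_, ⟨_, hx, rfl⟩, _, mem_connectedComponentIn hx, ?_⟩
  rw [← hsk]
  exact hs.self_of_nhds

/-- From a point of order `k𝟏` one can go off to infinity in the direction `-ε𝟏` without meeting the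
amoeba; far out, the segment to the diagonal avoids the amoeba as well. -/
theorem eventually_diagonal_mem_of_isOrder {n : ℕ} [NeZero n] {f : GL (Fin n) ℂ → ℂ}
    (hf : IsRegularFunction f) {k ε : ℤ} (hε : ε = 1 ∨ ε = -1) (hk : (fun _ => k) ∈ support f)
    (hmin : ∀ m ∈ support f, m ≠ (fun _ => k) → ε * (n * k) < ε * ∑ i, m i)
    {E : Set (EuclideanSpace ℝ (Fin n))} (hE : E ∈ complementComponents f)
    (hEk : IsOrder f E ((k : ℝ) • ones n)) :
    ∃ h₀ : ℝ, ∀ h ≤ h₀, h • toReal (fun _ => ε) ∈ E := by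
  obtain ⟨x, hxE, hxk⟩ := hEk
  have hx : x ∉ amoeba f := by
    obtain ⟨z, _, rfl⟩ := hE
    exact connectedComponentIn_subset _ _ hxE
  have hneg := (slope_eq_iff hf hε hk hmin hx hxk).1 rfl
  have hnonpos : ∀ h ≤ (0 : ℝ), x + h • toReal (fun _ => ε) ∈ (amoeba f)ᶜ := by
    intro h hh
    rcases hh.lt_or_eq with h1 | rfl
    · exact hneg h h1
    · simpa using hx
  have hcompact : IsCompact (segment ℝ x 0) := by
    rw [segment_eq_image']
    exact isCompact_Icc.image (by fun_prop)
  obtain ⟨t, ht⟩ := Filter.eventually_atBot.1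
    (eventually_translate_notMem_amoeba hf hε hk hmin hcompact)
  set u := min t 0
  have hut : u ≤ t := min_le_left _ _
  have hu0 : u ≤ 0 := min_le_right _ _
  -- move from `x` along the diagonal, then across to the diagonal itself
  have h1 : x + u • toReal (fun _ => ε) ∈ E := by
    refine mem_of_segment_subset hE hxE ?_
    simpa using segment_add_smul_subset hu0 hnonpos
  have h2 : u • toReal (fun _ => ε) ∈ E := by
    refine mem_of_segment_subset hE h1 ?_
    rintro _ ⟨α, β, hα, hβ, hαβ, rfl⟩
    have e : α • (x + u • toReal fun _ : Fin n => ε) + β • u • (toReal fun _ : Fin n => ε) =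
        (α • x + β • 0) + u • toReal fun _ : Fin n => ε := by
      rw [smul_add, add_assoc, ← add_smul, hαβ, one_smul, smul_zero, add_zero]
    rw [e]
    exact ht u hut _ ⟨α, β, hα, hβ, hαβ, rfl⟩
  refine ⟨u, fun h hh => mem_of_segment_subset hE h2 ?_⟩
  have := segment_add_smul_subset (S := (amoeba f)ᶜ) (y := 0) (w := toReal fun _ : Fin n => ε) hh
    fun r hr => ht r (hr.trans hut) 0 (right_mem_segment ℝ x 0)
  simpa using this

theorem not_isBounded_of_containsDiagonalHalfLine {n : ℕ} [NeZero n]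
    {E : Set (EuclideanSpace ℝ (Fin n))} (hE : ContainsDiagonalHalfLine E) :
    ¬ Bornology.IsBounded E := by
  intro hb
  obtain ⟨C, hC⟩ := hb.exists_norm_le
  have key : ∀ t : ℝ, t • ones n ∈ E → |t| ≤ C := by
    intro t ht
    refine le_trans ?_ (hC _ ht)
    have := PiLp.norm_apply_le (t • ones n) (0 : Fin n)
    simpa [ones] using this
  obtain ⟨t₀, h | h⟩ := hE
  · have := key _ (h (max t₀ (C + 1)) (le_max_left _ _))
    linarith [le_abs_self (max t₀ (C + 1)), le_max_right t₀ (C + 1)]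
  · have := key _ (h (min t₀ (-(C + 1))) (min_le_left _ _))
    linarith [neg_abs_le (min t₀ (-(C + 1))), min_le_right t₀ (-(C + 1))]

theorem containsDiagonalHalfLine_of_sign {n : ℕ} {E : Set (EuclideanSpace ℝ (Fin n))} {ε : ℤ}
    (hε : ε = 1 ∨ ε = -1) {h₀ : ℝ} (h : ∀ t ≤ h₀, t • toReal (fun _ => ε) ∈ E) :
    ContainsDiagonalHalfLine E := by
  simp only [toReal_const, smul_smul] at h
  rcases hε with rfl | rfl
  · exact ⟨h₀, Or.inr fun t ht => by simpa using h t ht⟩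
  · exact ⟨-h₀, Or.inl fun t ht => by simpa using h (-t) (by linarith)⟩

/-- A vertex which is an order lies in `ℤ𝟏`, because it has integer coordinates and every order is
a real multiple of `𝟏`. -/
theorem mem_diagonalLattice_of_mem_orderImage {n : ℕ} [NeZero n] {f : GL (Fin n) ℂ → ℂ}
    (hf : IsRegularFunction f) {v : EuclideanSpace ℝ (Fin n)} (hv : v ∈ vertices f)
    (hvo : v ∈ orderImage f) : v ∈ diagonalLattice n := by
  obtain ⟨E, hE, hEv⟩ := hvo
  obtain ⟨s, rfl⟩ := exists_eq_smul_ones_of_isOrder hf hE hEv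
  obtain ⟨m, -, hm⟩ := vertex_mem_support hv
  refine ⟨m 0, ?_⟩
  have := congrArg (fun x : EuclideanSpace ℝ (Fin n) => x 0) hm
  simp only [toReal, ones, PiLp.smul_apply, smul_eq_mul, mul_one] at this
  rw [this]

end MatrixAmoeba

theorem mainTheorem9 {n : ℕ} (hn : 0 < n) (f : GL (Fin n) ℂ → ℂ) (hf : IsRegularFunction f) :
    (∀ v ∈ vertices f,
      (v ∈ diagonalLattice n →
        (∃ E ∈ complementComponents f, IsOrder f E v ∧ ∀ x ∈ E, HasRonkinGradientAt f v x) ∧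
        (ones n ∈ normalCone (sNewt f) {v} ∨ -ones n ∈ normalCone (sNewt f) {v}) ∧
        (∀ E ∈ complementComponents f, IsOrder f E v →
          ¬ Bornology.IsBounded E ∧ ContainsDiagonalHalfLine E)) ∧
      (v ∉ diagonalLattice n → v ∉ orderImage f)) ∧
    (vertices f ∩ orderImage f).encard ≤ 2 := by
  have : NeZero n := ⟨hn.ne'⟩
  refine ⟨fun v hv => ⟨?_, fun hvd hvo =>
    hvd (mem_diagonalLattice_of_mem_orderImage hf hv hvo)⟩, ?_⟩
  · rintro ⟨k, rfl⟩
    obtain ⟨ε, hε, hmin⟩ := exists_sign_of_vertex hf hv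
    have hk := const_mem_support hv
    refine ⟨?_, ?_, fun E hE hEk => ?_⟩
    · obtain ⟨E, hE, hEk⟩ := exists_component_of_extreme hf hε hk hmin
      exact ⟨E, hE, hEk, hasRonkinGradientAt_of_isOrder hf hE hEk⟩
    · have hcone := sign_smul_ones_mem_normalCone hmin
      rcases hε with rfl | rfl
      · left
        simpa using hcone
      · right
        simpa using hcone
    · obtain ⟨h₀, hh₀⟩ := eventually_diagonal_mem_of_isOrder hf hε hk hmin hE hEk
      have hline := containsDiagonalHalfLine_of_sign hε hh₀
      exact ⟨not_isBounded_of_containsDiagonalHalfLine hline, hline⟩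
  · refine le_trans (Set.encard_le_encard ?_) (encard_vertices_inter_diagonalLattice_le hf)
    exact fun v hv => ⟨hv.1, mem_diagonalLattice_of_mem_orderImage hf hv.1 hv.2⟩
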